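/- **Model.** Let $R_0>1$, $R_c>0$ and $R_1=R_0+R_c$. Let $N$ and $N^c$ be independent Poisson processes of rates $R_0$ (arrivals from the free server) and $R_c$ (arrivals from the costly server). The file is infinite. The buffer size under a stationary Markov policy $\pi:\mathbb R\to\{0,1\}$ with initial buffer size $D$ is the process (adapted to the history of $N$ and $N^c$) $$x_t=D+N_t+\int_0^t u_\tau\,dN^c_\tau-t,\qquad u_t=\pi(x_{t-}),\qquad t\ge 0,$$ where $u_t=1$ means that the costly server is used at time $t$. Playback is interrupted at $\tau_e=\inf\{t:x_t\le 0\}$; streaming ends there, and no cost is incurred after $\tau_e$. The interruption probability is $p^\pi(D)=\Pr(\tau_e<\infty)$, and the cost of $\pi$ at level $\epsilon$ is the expected usage time of the costly server, $$J^\pi(D,\epsilon)=\mathbb E\Big[\int_0^{\tau_e}u_t\,dt\Big]\ \text{ if } p^\pi(D)\le\epsilon,\qquad J^\pi(D,\epsilon)=\infty\ \text{ otherwise.}$$ The risky policy $\pi^T$ with threshold $T$ is $\pi^T(x)=1$ if $0<x<T$ and $\pi^T(x)=0$ otherwise. **Constants.** Let $\bar r(R)=\sup\{r:\ r+R(e^{-r}-1)=0\}$,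 $\alpha_0=\bar r(R_0)$, $\alpha_1=\bar r(R_1)$, and assume $\alpha_0<2$. Put $$\beta=\frac{\alpha_1}{\alpha_0(1-\alpha_0/2)},\qquad \bar D=\frac1{\alpha_1}\log\frac{\beta}{\epsilon}.$$ Let $0<\epsilon<1$ and $\frac1{\alpha_1}\log\frac1\epsilon\le D\le\frac1{\alpha_0}\log\frac1\epsilon$, and define $$T^*=\begin{cases}\dfrac{1}{\alpha_1-\alpha_0}\Big[\log\dfrac\beta\epsilon-\alpha_0D\Big], & D\ge\bar D,\\[2mm] \dfrac1{\alpha_1}\log\dfrac{\epsilon+\beta(1-e^{-\alpha_1D})-1}{\epsilon-e^{-\alpha_1D}}, & D\le\bar D.\end{cases}$$ **Theorem.** If $D\ge\bar D$, then $$J^{\pi^{T^*}}(D,\epsilon)\le\frac{\beta}{\alpha_1(R_1-1)}\,e^{-\alpha_0(D-T^*)}.$$ If $D\le\bar D$ and $D>\frac1{\alpha_1}\log\frac1\epsilon$, then $$J^{\pi^{T^*}}(D,\epsilon)\le\frac{1-e^{-\alpha_1D}}{(R_1-1)(1-e^{-\alpha_1T^*})}\Big(T^*+1+\frac\beta{\alpha_1}\Big)-\frac{D}{R_1-1}.$$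 (At $D=\frac1{\alpha_1}\log\frac1\epsilon$, both $T^*$ and the second bound are $+\infty$.) -/

import Mathlib

open MeasureTheory ProbabilityTheory Set
open scoped NNReal ENNReal

noncomputable section

namespace Streaming

/-- The largest root `r̄(R)` of `γ(r) = r + R (e^{-r} - 1)`. -/
def rBar (R : ℝ) : ℝ := sSup {r : ℝ | r + R * (Real.exp (-r) - 1) = 0}

variable {Ω : Type*} [MeasurableSpace Ω]

/-- `N` is a (homogeneous) Poisson process of rate `R` under `μ`: a counting process started at `0`
with independent increments, where `N t - N s` is Poisson distributed with mean `R (t - s)`. -/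
structure IsPoissonProcess (μ : Measure Ω) (R : ℝ≥0) (N : ℝ≥0 → Ω → ℕ) : Prop where
  measurable : ∀ t, Measurable (N t)
  zero : ∀ ω, N 0 ω = 0
  mono : ∀ ω, Monotone fun t => N t ω
  rightCont : ∀ ω t, ContinuousWithinAt (fun s => N s ω) (Ici t) t
  indepIncrements : HasIndepIncrements N μ
  law : ∀ s t, s ≤ t → HasLaw (fun ω => N t ω - N s ω) (poissonMeasure (R * (t - s))) μ

/-- The information carried by the arrivals of both servers up to time `t`. -/
abbrev arrivalHistory (N Nc : ℝ≥0 → Ω → ℕ) (t : ℝ≥0) : MeasurableSpace Ω :=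
  ⨆ s ∈ Iic t, (MeasurableSpace.comap (N s) ⊤ ⊔ MeasurableSpace.comap (Nc s) ⊤)

/-- The pathwise integral `∫_{(0,t]} u dn` against a counting path `n`: the sum of `u s` times the
jump of `n` at `s`, over the (finitely many) jump times `s ∈ (0,t]`. -/
def countingIntegral (u : ℝ≥0 → ℝ) (n : ℝ≥0 → ℕ) (t : ℝ≥0) : ℝ :=
  ∑ᶠ s ∈ Ioc 0 t, u s * ((n s : ℝ) - Function.leftLim (fun r => (n r : ℝ)) s)

/-- The action at time `t` when the stationary Markov policy `π` is applied to the buffer path `y`.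
Actions are taken before an arrival at time `t` is seen, so they depend on the left limit of `y`. -/
def action (π : ℝ → ℕ) (y : ℝ≥0 → ℝ) (t : ℝ≥0) : ℕ := π (Function.leftLim y t)

/-- `x` is the buffer size process under the stationary Markov policy `π`, with initial buffer size
`D`, free arrivals `N` and costly arrivals `Nc`:
`x_t = D + N_t + ∫_0^t u_τ dNc_τ - t`, with `u` the action of `π`. -/
structure IsBufferProcess (N Nc : ℝ≥0 → Ω → ℕ) (π : ℝ → ℕ) (D : ℝ) (x : ℝ≥0 → Ω → ℝ) :
    Prop where
  adapted : ∀ t, Measurable[arrivalHistory N Nc t] (x t)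
  dynamics : ∀ ω t, x t ω =
    D + N t ω
      + countingIntegral (fun s => (action π (fun r => x r ω) s : ℝ)) (fun s => Nc s ω) t - t

/-- The time `τ_e = inf {t | x_t ≤ 0}` of interruption along a buffer path (`∞` if there is none). -/
def interruptionTime (y : ℝ≥0 → ℝ) : ℝ≥0∞ := ⨅ t : ℝ≥0, ⨅ _ : y t ≤ 0, (t : ℝ≥0∞)

/-- The interruption probability, for an infinite file. -/
def interruptionProb (μ : Measure Ω) (x : ℝ≥0 → Ω → ℝ) : ℝ≥0∞ :=
  μ {ω | interruptionTime (fun t => x t ω) < ⊤}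

/-- The expected time during which the costly server is used, for an infinite file. Streaming ends
with an interruption: the costly server is not used from then on. -/
def expectedUsage (μ : Measure Ω) (π : ℝ → ℕ) (x : ℝ≥0 → Ω → ℝ) : ℝ≥0∞ :=
  ∫⁻ ω, (∫⁻ t in {t : ℝ | 0 < t ∧ ENNReal.ofReal t < interruptionTime (fun r => x r ω)},
    (action π (fun r => x r ω) t.toNNReal : ℝ≥0∞)) ∂μ

open Classical in
/-- The cost `J^π(D, ε)` of the policy `π`, whose buffer process started at `D` is `x`: the expected
usage of the costly server if the policy is feasible, i.e. if the interruption probability is at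
most `ε`, and `∞` otherwise. -/
def cost (μ : Measure Ω) (π : ℝ → ℕ) (x : ℝ≥0 → Ω → ℝ) (ε : ℝ) : ℝ≥0∞ :=
  if interruptionProb μ x ≤ ENNReal.ofReal ε then expectedUsage μ π x else ⊤

/-- The online risky policy with threshold `T`: the costly server is used iff `0 < x < T`. -/
def riskyPolicy (T : ℝ) (x : ℝ) : ℕ := (Ioo 0 T).indicator 1 x

/-- The constant `β = α₁ / (α₀ (1 - α₀ / 2))`. -/
def betaConst (α₀ α₁ : ℝ) : ℝ := α₁ / (α₀ * (1 - α₀ / 2))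

/-- `D̄ = (1 / α₁) log (β / ε)`. -/
def DBar (α₀ α₁ ε : ℝ) : ℝ := 1 / α₁ * Real.log (betaConst α₀ α₁ / ε)

open Classical in
/-- The threshold `T*` as a function of `D` and `ε`. -/
def TStar (α₀ α₁ D ε : ℝ) : ℝ :=
  if DBar α₀ α₁ ε ≤ D then
    1 / (α₁ - α₀) * (Real.log (betaConst α₀ α₁ / ε) - α₀ * D)
  else
    1 / α₁ * Real.log ((ε + betaConst α₀ α₁ * (1 - Real.exp (-α₁ * D)) - 1) /
      (ε - Real.exp (-α₁ * D)))

/-- The region `(1 / α₁) log (1 / ε) ≤ D ≤ (1 / α₀) log (1 / ε)`, with `0 < ε < 1`. -/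
def region (α₀ α₁ : ℝ) : Set (ℝ × ℝ) :=
  {q | 0 < q.2 ∧ q.2 < 1 ∧ 1 / α₁ * Real.log (1 / q.2) ≤ q.1 ∧ q.1 ≤ 1 / α₀ * Real.log (1 / q.2)}

end Streaming

end

/-! The argument is Dynkin's inequality for two explicit supersolutions. Under the risky policy the
buffer is Markov, with generator `L F(x) = -F'(x) + R (F(x+1) - F(x))`, where `R = R₀ + Rc` below
`T` and `R = R₀` above. The buffer descends continuously, so it is `0` at interruption. Hence, if `F
≥ 0` on `[0, ∞)`, `L F ≤ -κ` below `T` and `L F ≤ 0` above, then `F(0) P(τ_e < ∞) + κ E[usage] ≤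
F(D)`. The choice `F(0) = 1`, `κ = 0` bounds the interruption probability; `F(0) = 0`, `κ = 1`
bounds the cost.

Both functions are instances of `barrier`. As `α₁` and `α₀` are roots for the rates `R₁` and `R₀`,
each exponential is annihilated by the generator of its region, and the linear term produces `-κ`.
Gluing at `T` preserves the inequality under two conditions (`exists_isSupersolution_barrier`): the
kink at `T` is concave, and up to `T + 1` the upper part lies below the continuation of the lower
part, since one arrival can jump across `T`. For the interruption barrier the slopes agree at `T`.
For the usage barrier the second condition is secured by `1 - e^{-α₀ o} ≥ o α₀ (1 - α₀/2)` on
`[0,1]`; this dictates the value `β / (α₁ (R₁ - 1))` at `T` and is the origin of `β`.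

The threshold `T*` makes a weakening of the interruption barrier at `D`, obtained from `α₁/α₀ ≤ β`,
equal to `ε`; so the policy is feasible. The usage barrier at `D` then gives the two bounds.

Dynkin's inequality is proved on a time grid (`grid_drift`): `integral_step_le` bounds the expected
change over a step of length `δ` up to `O(δ²)`, from the independence of Poisson increments from the
past. With `(j+1)³` steps of length `(j+1)⁻²` the horizon is `j + 1` and the total error is
`O(1/j)`. Continuity of measure and Fatou's lemma pass to the limit. -/

namespace Streaming

open Filter Topology Function

/-! ### The largest root and its monotonicity in the rate -/

section Root

variable {R R' : ℝ}

lemma exists_root_of_neg {a : ℝ} (haR : a ≤ R) (hR : 0 < R)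
    (ha : a + R * (Real.exp (-a) - 1) < 0) : ∃ r, a < r ∧ r + R * (Real.exp (-r) - 1) = 0 := by
  have hcont : ContinuousOn (fun r : ℝ => r + R * (Real.exp (-r) - 1)) (Icc a R) := by fun_prop
  have hpos : 0 < R + R * (Real.exp (-R) - 1) := by
    have := mul_pos hR (Real.exp_pos (-R))
    linarith
  obtain ⟨r, hr, h0⟩ := intermediate_value_Icc haR hcont ⟨ha.le, hpos.le⟩
  refine ⟨r, lt_of_le_of_ne hr.1 ?_, h0⟩
  rintro rfl
  exact ha.ne h0

lemma bddAbove_roots (hR : 0 < R) : BddAbove {r : ℝ | r + R * (Real.exp (-r) - 1) = 0} := by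
  refine ⟨R, fun r hr => ?_⟩
  have h : r + R * (Real.exp (-r) - 1) = 0 := hr
  have := mul_pos hR (Real.exp_pos (-r))
  linarith

lemma rBar_root (hR : 0 < R) : rBar R + R * (Real.exp (-rBar R) - 1) = 0 := by
  have hclosed : IsClosed {r : ℝ | r + R * (Real.exp (-r) - 1) = 0} :=
    isClosed_eq (by fun_prop) continuous_const
  exact hclosed.csSup_mem ⟨0, by simp⟩ (bddAbove_roots hR)

lemma rBar_le (hR : 0 < R) : rBar R ≤ R := by
  have := rBar_root hR
  have := mul_pos hR (Real.exp_pos (-rBar R))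
  linarith

/-- Since `(1 + a) e^{-a} ≤ 1`, the function times `1 + a` is at most `a (1 + a - R)`, which is
negative at `a = (R - 1) / 2`; a root further right follows. -/
lemma rBar_pos (hR : 1 < R) : 0 < rBar R := by
  set a := (R - 1) / 2 with ha
  have ha0 : 0 < a := by rw [ha]; linarith
  have hneg : a + R * (Real.exp (-a) - 1) < 0 := by
    have h1 : (1 + a) * Real.exp (-a) ≤ 1 := by
      have h2 : (1 + a) * Real.exp (-a) ≤ Real.exp a * Real.exp (-a) :=
        mul_le_mul_of_nonneg_right (by linarith [Real.add_one_le_exp a]) (Real.exp_pos _).le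
      rwa [← Real.exp_add, add_neg_cancel, Real.exp_zero] at h2
    have h3 : (1 + a) * (a + R * (Real.exp (-a) - 1)) ≤ a * (1 + a - R) := by nlinarith
    have h4 : a * (1 + a - R) < 0 := mul_neg_of_pos_of_neg ha0 (by linarith)
    by_contra! h
    nlinarith
  obtain ⟨r, har, hr⟩ := exists_root_of_neg (by linarith) (by linarith) hneg
  exact (ha0.trans har).trans_le (le_csSup (bddAbove_roots (by linarith)) hr)

/-- At the root `r` for `R`, the larger rate adds `(R' - R)(e^{-r} - 1) < 0`, so the function for
`R'` still has to cross zero to the right of `r`. -/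
lemma rBar_lt_rBar (hR : 1 < R) (hRR' : R < R') : rBar R < rBar R' := by
  have h0 := rBar_root (R := R) (by linarith)
  have hpos := rBar_pos hR
  have hexp : Real.exp (-rBar R) < 1 := Real.exp_lt_one_iff.2 (by linarith)
  have hneg : rBar R + R' * (Real.exp (-rBar R) - 1) < 0 := by nlinarith
  obtain ⟨r, har, hr⟩ :=
    exists_root_of_neg ((rBar_le (by linarith)).trans hRR'.le) (by linarith) hneg
  exact har.trans_le (le_csSup (bddAbove_roots (by linarith)) hr)

end Root

/-! ### Supersolutions glued at the threshold -/

section Barrier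

/-- `F` is, up to errors of second order in the step size `h ≤ h₀`, a supersolution of the
equations `L F = -κ` below the threshold `T`, where both servers are used, and `L F = 0` above it,
where only the free server is used. -/
structure IsSupersolution (R₀ Rc T κ h₀ C : ℝ) (F : ℝ → ℝ) : Prop where
  continuous : Continuous F
  C_nonneg : 0 ≤ C
  lipschitz : ∀ x y, -1 ≤ x → -1 ≤ y → F x ≤ F y + C * |x - y|
  le_C : ∀ x, -1 ≤ x → F x ≤ C
  nonneg : ∀ x, 0 ≤ x → 0 ≤ F x
  below : ∀ h, 0 < h → h ≤ h₀ → ∀ x, 0 < x → x < T →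
    F (x - h) + h * (R₀ + Rc) * (F (x + 1) - F x) + h * κ ≤ F x + C * h ^ 2
  above : ∀ h, 0 < h → h ≤ h₀ → ∀ x, T ≤ x →
    F (x - h) + h * R₀ * (F (x + 1) - F x) ≤ F x + C * h ^ 2
  jump_le : F (T + 1) ≤ F T

/-- The function that equals `p + q e^{-α₁ x} + s x` below `T`, and decays like `c e^{-α₀ (x - T)}`
above `T`. -/
noncomputable def barrier (p q s c α₀ α₁ T x : ℝ) : ℝ :=
  p + q * Real.exp (-α₁ * min x T) + s * min x T + c * (Real.exp (-α₀ * (max x T - T)) - 1)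

variable {p q s c α₀ α₁ T κ R₀ Rc x : ℝ}

lemma barrier_of_le (hx : x ≤ T) :
    barrier p q s c α₀ α₁ T x = p + q * Real.exp (-α₁ * x) + s * x := by
  simp [barrier, min_eq_left hx, max_eq_right hx]

lemma barrier_of_ge (hc : p + q * Real.exp (-α₁ * T) + s * T = c) (hx : T ≤ x) :
    barrier p q s c α₀ α₁ T x = c * Real.exp (-α₀ * (x - T)) := by
  rw [barrier, min_eq_right hx, max_eq_left hx, hc]
  ring

lemma abs_exp_mul_sub_le {α x y : ℝ} (hα : 0 ≤ α) (hx : -1 ≤ x) (hy : -1 ≤ y) :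
    |Real.exp (-α * x) - Real.exp (-α * y)| ≤ α * Real.exp α * |x - y| := by
  wlog hxy : x ≤ y generalizing x y
  · rw [abs_sub_comm, abs_sub_comm x y]
    exact this hy hx (le_of_not_ge hxy)
  have h1 : Real.exp (-α * y) ≤ Real.exp (-α * x) := Real.exp_le_exp.2 (by nlinarith)
  rw [abs_of_nonneg (by linarith), abs_of_nonpos (by linarith)]
  have h2 : Real.exp (-α * y) = Real.exp (-α * x) * Real.exp (-α * (y - x)) := by
    rw [← Real.exp_add]
    ring_nf
  have h3 : 1 + -α * (y - x) ≤ Real.exp (-α * (y - x)) := by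
    linarith [Real.add_one_le_exp (-α * (y - x))]
  have h4 : Real.exp (-α * x) ≤ Real.exp α := Real.exp_le_exp.2 (by nlinarith)
  have h5 : 0 ≤ α * (y - x) := mul_nonneg hα (by linarith)
  calc Real.exp (-α * x) - Real.exp (-α * y)
      = Real.exp (-α * x) * (1 - Real.exp (-α * (y - x))) := by rw [h2]; ring
    _ ≤ Real.exp (-α * x) * (α * (y - x)) :=
        mul_le_mul_of_nonneg_left (by linarith) (Real.exp_pos _).le
    _ ≤ Real.exp α * (α * (y - x)) := mul_le_mul_of_nonneg_right h4 h5
    _ = α * Real.exp α * -(x - y) := by ring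

lemma exp_sub_one_sub_le {a : ℝ} (ha : 0 ≤ a) (ha1 : a ≤ 1) :
    |Real.exp a - 1 - a| ≤ a ^ 2 :=
  Real.abs_exp_sub_one_sub_id_le (by rwa [abs_of_nonneg ha])

/-- Clamping at `T` is 1-Lipschitz. The restriction to `[-1, ∞)` keeps the exponentials bounded and
leaves room for a grid step of length at most `1` to pass below `0`. -/
lemma barrier_lipschitz (hα₀ : 0 ≤ α₀) (hα₁ : 0 ≤ α₁) (hT : 0 ≤ T) {x y : ℝ} (hx : -1 ≤ x)
    (hy : -1 ≤ y) :
    |barrier p q s c α₀ α₁ T x - barrier p q s c α₀ α₁ T y| ≤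
      (|q| * (α₁ * Real.exp α₁) + |s| + |c| * (α₀ * Real.exp α₀)) * |x - y| := by
  have hmin : |min x T - min y T| ≤ |x - y| := by
    simpa using abs_inf_sub_inf_le_abs x y T
  have hmax : |max x T - max y T| ≤ |x - y| := by
    simpa using abs_sup_sub_sup_le_abs x y T
  have h1 := abs_exp_mul_sub_le hα₁ (le_min hx (by linarith : -1 ≤ T))
    (le_min hy (by linarith : -1 ≤ T))
  have h2 := abs_exp_mul_sub_le (x := max x T - T) (y := max y T - T) hα₀
    (by linarith [le_max_right x T]) (by linarith [le_max_right y T])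
  rw [sub_sub_sub_cancel_right] at h2
  have h1' := h1.trans (mul_le_mul_of_nonneg_left hmin (by positivity))
  have h2' := h2.trans (mul_le_mul_of_nonneg_left hmax (by positivity))
  have heq : barrier p q s c α₀ α₁ T x - barrier p q s c α₀ α₁ T y =
      q * (Real.exp (-α₁ * min x T) - Real.exp (-α₁ * min y T)) + s * (min x T - min y T) +
        c * (Real.exp (-α₀ * (max x T - T)) - Real.exp (-α₀ * (max y T - T))) := by
    unfold barrier; ring
  rw [heq]
  refine (abs_add_three _ _ _).trans ?_
  rw [abs_mul, abs_mul, abs_mul]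
  have e1 := mul_le_mul_of_nonneg_left h1' (abs_nonneg q)
  have e2 := mul_le_mul_of_nonneg_left hmin (abs_nonneg s)
  have e3 := mul_le_mul_of_nonneg_left h2' (abs_nonneg c)
  linarith

/-- Second order expansion of the part of the barrier below `T`. -/
lemma lower_step (hα₁ : 0 ≤ α₁) (hroot : α₁ + (R₀ + Rc) * (Real.exp (-α₁) - 1) = 0)
    (hslope : s * (R₀ + Rc - 1) = -κ) {h : ℝ} (hh : 0 < h) (hh1 : α₁ * h ≤ 1) (hx : 0 ≤ x) :
    (p + q * Real.exp (-α₁ * (x - h)) + s * (x - h)) + h * (R₀ + Rc) *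
        ((p + q * Real.exp (-α₁ * (x + 1)) + s * (x + 1)) -
          (p + q * Real.exp (-α₁ * x) + s * x)) + h * κ ≤
      (p + q * Real.exp (-α₁ * x) + s * x) + |q| * α₁ ^ 2 * h ^ 2 := by
  have e1 : Real.exp (-α₁ * (x - h)) = Real.exp (-α₁ * x) * Real.exp (α₁ * h) := by
    rw [← Real.exp_add]; ring_nf
  have e2 : Real.exp (-α₁ * (x + 1)) = Real.exp (-α₁ * x) * Real.exp (-α₁) := by
    rw [← Real.exp_add]; ring_nf
  have hE : Real.exp (-α₁ * x) ≤ 1 := Real.exp_le_one_iff.2 (by nlinarith)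
  have hsq := exp_sub_one_sub_le (mul_nonneg hα₁ hh.le) hh1
  have hb : q * Real.exp (-α₁ * x) * (Real.exp (α₁ * h) - 1 - α₁ * h) ≤ |q| * (α₁ * h) ^ 2 := by
    refine (le_abs_self _).trans ?_
    rw [abs_mul, abs_mul, abs_of_pos (Real.exp_pos (-α₁ * x))]
    have : |q| * Real.exp (-α₁ * x) ≤ |q| := mul_le_of_le_one_right (abs_nonneg q) hE
    exact mul_le_mul this hsq (abs_nonneg _) (abs_nonneg _)
  rw [e1, e2]
  set E := Real.exp (-α₁ * x)
  have hr : (R₀ + Rc) * (Real.exp (-α₁) - 1) = -α₁ := by linarith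
  have key : (p + q * (E * Real.exp (α₁ * h)) + s * (x - h)) + h * (R₀ + Rc) *
        ((p + q * (E * Real.exp (-α₁)) + s * (x + 1)) - (p + q * E + s * x)) + h * κ =
      (p + q * E + s * x) + q * E * (Real.exp (α₁ * h) - 1 - α₁ * h) := by
    linear_combination (h * q * E) * hr + h * hslope
  rw [key]
  nlinarith

/-- Second order expansion of the part of the barrier above `T`. -/
lemma upper_step (hα₀ : 0 ≤ α₀) (hc0 : 0 ≤ c) (hroot : α₀ + R₀ * (Real.exp (-α₀) - 1) = 0)
    {h : ℝ} (hh : 0 < h) (hh1 : α₀ * h ≤ 1) (hx : T ≤ x) :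
    c * Real.exp (-α₀ * (x - h - T)) + h * R₀ *
        (c * Real.exp (-α₀ * (x + 1 - T)) - c * Real.exp (-α₀ * (x - T))) ≤
      c * Real.exp (-α₀ * (x - T)) + c * α₀ ^ 2 * h ^ 2 := by
  have e1 : Real.exp (-α₀ * (x - h - T)) = Real.exp (-α₀ * (x - T)) * Real.exp (α₀ * h) := by
    rw [← Real.exp_add]; ring_nf
  have e2 : Real.exp (-α₀ * (x + 1 - T)) = Real.exp (-α₀ * (x - T)) * Real.exp (-α₀) := by
    rw [← Real.exp_add]; ring_nf
  have hE : Real.exp (-α₀ * (x - T)) ≤ 1 := Real.exp_le_one_iff.2 (by nlinarith)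
  have hsq := (abs_le.1 (exp_sub_one_sub_le (mul_nonneg hα₀ hh.le) hh1)).2
  have hb : c * Real.exp (-α₀ * (x - T)) * (Real.exp (α₀ * h) - 1 - α₀ * h) ≤
      c * (α₀ * h) ^ 2 := by
    have h1 : 0 ≤ c * Real.exp (-α₀ * (x - T)) := by positivity
    have h2 : c * Real.exp (-α₀ * (x - T)) ≤ c := mul_le_of_le_one_right hc0 hE
    exact (mul_le_mul_of_nonneg_left hsq h1).trans (mul_le_mul_of_nonneg_right h2 (by positivity))
  rw [e1, e2]
  set E := Real.exp (-α₀ * (x - T))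
  have key : c * (E * Real.exp (α₀ * h)) + h * R₀ * (c * (E * Real.exp (-α₀)) - c * E) =
      c * E + c * E * (Real.exp (α₀ * h) - 1 - α₀ * h) := by
    linear_combination (h * c * E) * hroot
  rw [key]
  nlinarith

/-- Below `T`, the barrier is at most the continuation of its part above `T`, up to second order. -/
lemma kink_step (hα₁ : 0 ≤ α₁) (hT : 0 ≤ T) (hc0 : 0 ≤ c)
    (hc : p + q * Real.exp (-α₁ * T) + s * T = c)
    (hkink : -α₀ * c ≤ -α₁ * (q * Real.exp (-α₁ * T)) + s) {w h : ℝ} (hw : 0 ≤ w) (hwh : w ≤ h)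
    (hh1 : α₁ * h ≤ 1) :
    p + q * Real.exp (-α₁ * (T - w)) + s * (T - w) ≤
      c * Real.exp (-α₀ * (T - w - T)) + |q| * α₁ ^ 2 * h ^ 2 := by
  have hw1 : α₁ * w ≤ 1 := (mul_le_mul_of_nonneg_left hwh hα₁).trans hh1
  have e1 : Real.exp (-α₁ * (T - w)) = Real.exp (-α₁ * T) * Real.exp (α₁ * w) := by
    rw [← Real.exp_add]; ring_nf
  have e2 : 1 + α₀ * w ≤ Real.exp (-α₀ * (T - w - T)) := by
    have := Real.add_one_le_exp (-α₀ * (T - w - T))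
    linarith
  have hE : Real.exp (-α₁ * T) ≤ 1 := Real.exp_le_one_iff.2 (by nlinarith)
  have hsq := exp_sub_one_sub_le (mul_nonneg hα₁ hw) hw1
  have hb : q * Real.exp (-α₁ * T) * (Real.exp (α₁ * w) - 1 - α₁ * w) ≤ |q| * (α₁ * w) ^ 2 := by
    refine (le_abs_self _).trans ?_
    rw [abs_mul, abs_mul, abs_of_pos (Real.exp_pos (-α₁ * T))]
    have : |q| * Real.exp (-α₁ * T) ≤ |q| := mul_le_of_le_one_right (abs_nonneg q) hE
    exact mul_le_mul this hsq (abs_nonneg _) (abs_nonneg _)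
  have hb' : |q| * (α₁ * w) ^ 2 ≤ |q| * α₁ ^ 2 * h ^ 2 := by
    rw [mul_pow, ← mul_assoc]
    exact mul_le_mul_of_nonneg_left (pow_le_pow_left₀ hw hwh 2) (by positivity)
  have h3 := mul_le_mul_of_nonneg_left e2 hc0
  have h4 := mul_le_mul_of_nonneg_left hkink hw
  rw [e1]
  set E := Real.exp (-α₁ * T)
  have key : p + q * (E * Real.exp (α₁ * w)) + s * (T - w) =
      c + q * E * (Real.exp (α₁ * w) - 1 - α₁ * w) - w * (-α₁ * (q * E) + s) := by
    linear_combination hc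
  rw [key]
  linarith

/-- Each piece solves its equation exactly, so only steps that change region need care. `hover`
handles arrivals that jump above `T`, and `hkink` handles the drift that falls below `T`. Steps up
to `1 / α₁` keep the exponents in the range of the quadratic estimate of `exp`. -/
theorem exists_isSupersolution_barrier (hα₀ : 0 < α₀) (hα : α₀ ≤ α₁) (hT : 0 < T) (hc0 : 0 ≤ c)
    (hR₀ : 0 ≤ R₀) (hRc : 0 ≤ Rc)
    (hroot₀ : α₀ + R₀ * (Real.exp (-α₀) - 1) = 0)
    (hroot₁ : α₁ + (R₀ + Rc) * (Real.exp (-α₁) - 1) = 0)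
    (hslope : s * (R₀ + Rc - 1) = -κ)
    (hc : p + q * Real.exp (-α₁ * T) + s * T = c)
    (hkink : -α₀ * c ≤ -α₁ * (q * Real.exp (-α₁ * T)) + s)
    (hover : ∀ o, 0 ≤ o → o ≤ 1 →
      c * Real.exp (-α₀ * o) ≤ p + q * Real.exp (-α₁ * (T + o)) + s * (T + o))
    (hnonneg : ∀ x, 0 ≤ x → x ≤ T → 0 ≤ p + q * Real.exp (-α₁ * x) + s * x) :
    ∃ C, IsSupersolution R₀ Rc T κ (1 / α₁) C (barrier p q s c α₀ α₁ T) := by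
  have hα₁ : 0 < α₁ := hα₀.trans_le hα
  set Λ := |q| * (α₁ * Real.exp α₁) + |s| + |c| * (α₀ * Real.exp α₀) with hΛ
  set K := |p| + |q| * Real.exp α₁ + |s| * (1 + T) with hK
  set Q := |q| * α₁ ^ 2 + c * α₀ ^ 2 with hQ
  have hΛ0 : 0 ≤ Λ := by positivity
  have hK0 : 0 ≤ K := by positivity
  have hQ0 : 0 ≤ Q := by positivity
  have step : ∀ h, 0 < h → h ≤ 1 / α₁ → α₁ * h ≤ 1 ∧ α₀ * h ≤ 1 := by
    intro h hh hh1
    have h1 : α₁ * h ≤ 1 := by rwa [le_div_iff₀ hα₁, mul_comm] at hh1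
    exact ⟨h1, (mul_le_mul_of_nonneg_right hα hh.le).trans h1⟩
  refine ⟨Λ + K + Q, ?_, by positivity, ?_, ?_, ?_, ?_, ?_, ?_⟩
  · unfold barrier; fun_prop
  · intro x y hx hy
    have h1 := (le_abs_self _).trans
      (barrier_lipschitz (p := p) (q := q) (s := s) (c := c) hα₀.le hα₁.le hT.le hx hy)
    have h2 : Λ * |x - y| ≤ (Λ + K + Q) * |x - y| :=
      mul_le_mul_of_nonneg_right (by linarith) (abs_nonneg _)
    linarith
  · intro x hx
    have hm : -1 ≤ min x T := le_min hx (by linarith)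
    have h1 : q * Real.exp (-α₁ * min x T) ≤ |q| * Real.exp α₁ := by
      refine mul_le_mul (le_abs_self q) (Real.exp_le_exp.2 (by nlinarith)) (Real.exp_pos _).le
        (abs_nonneg q)
    have h2 : s * min x T ≤ |s| * (1 + T) := by
      refine (le_abs_self _).trans ?_
      rw [abs_mul]
      refine mul_le_mul_of_nonneg_left (abs_le.2 ⟨by linarith, ?_⟩) (abs_nonneg s)
      linarith [min_le_right x T]
    have h3 : c * (Real.exp (-α₀ * (max x T - T)) - 1) ≤ 0 := by
      refine mul_nonpos_of_nonneg_of_nonpos hc0 ?_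
      have : Real.exp (-α₀ * (max x T - T)) ≤ 1 :=
        Real.exp_le_one_iff.2 (by nlinarith [le_max_right x T])
      linarith
    have := le_abs_self p
    unfold barrier
    linarith
  · intro x hx
    rcases le_total x T with h | h
    · rw [barrier_of_le h]
      exact hnonneg x hx h
    · rw [barrier_of_ge hc h]
      positivity
  · intro h hh hh1 x hx hxT
    obtain ⟨s1, -⟩ := step h hh hh1
    have hle : barrier p q s c α₀ α₁ T (x + 1) ≤
        p + q * Real.exp (-α₁ * (x + 1)) + s * (x + 1) := by
      rcases le_total (x + 1) T with h | h
      · rw [barrier_of_le h]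
      · rw [barrier_of_ge hc h]
        have := hover (x + 1 - T) (by linarith) (by linarith)
        rwa [add_sub_cancel] at this
    have h1 := lower_step (p := p) (q := q) hα₁.le hroot₁ hslope hh s1 hx.le
    rw [barrier_of_le (x := x - h) (by linarith), barrier_of_le (x := x) hxT.le]
    have h2 : h * (R₀ + Rc) * barrier p q s c α₀ α₁ T (x + 1) ≤ h * (R₀ + Rc) *
        (p + q * Real.exp (-α₁ * (x + 1)) + s * (x + 1)) :=
      mul_le_mul_of_nonneg_left hle (by positivity)
    have h3 : |q| * α₁ ^ 2 * h ^ 2 ≤ (Λ + K + Q) * h ^ 2 := by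
      refine mul_le_mul_of_nonneg_right ?_ (by positivity)
      have : 0 ≤ c * α₀ ^ 2 := by positivity
      linarith
    linarith
  · intro h hh hh1 x hx
    obtain ⟨s1, s0⟩ := step h hh hh1
    have hle : barrier p q s c α₀ α₁ T (x - h) ≤
        c * Real.exp (-α₀ * (x - h - T)) + |q| * α₁ ^ 2 * h ^ 2 := by
      rcases le_total T (x - h) with h' | h'
      · rw [barrier_of_ge hc h']
        have : 0 ≤ |q| * α₁ ^ 2 * h ^ 2 := by positivity
        linarith
      · rw [barrier_of_le h']
        have := kink_step (w := T - (x - h)) hα₁.le hT.le hc0 hc hkink (by linarith)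
          (by linarith) s1
        rwa [sub_sub_cancel] at this
    have h1 := upper_step (c := c) hα₀.le hc0 hroot₀ hh s0 hx
    rw [barrier_of_ge (x := x) hc hx, barrier_of_ge (x := x + 1) hc (by linarith)]
    have h3 : |q| * α₁ ^ 2 * h ^ 2 + c * α₀ ^ 2 * h ^ 2 ≤ (Λ + K + Q) * h ^ 2 := by
      rw [← add_mul]
      exact mul_le_mul_of_nonneg_right (by linarith) (by positivity)
    linarith
  · rw [barrier_of_ge hc (by linarith : T ≤ T + 1), barrier_of_ge hc le_rfl]
    refine mul_le_mul_of_nonneg_left (Real.exp_le_exp.2 ?_) hc0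
    nlinarith

end Barrier

/-! ### Counting paths and their pathwise integrals -/

section Paths

/-- The left limit of a path at `t` is at least any lower bound of the path on `[s, t]`. -/
lemma le_leftLim_of_forall {y : ℝ≥0 → ℝ} {s t : ℝ≥0} {c : ℝ} (hst : s < t)
    (h : ∀ r ∈ Icc s t, c ≤ y r) : c ≤ leftLim y t := by
  have hne : (𝓝[<] t).NeBot := nhdsLT_neBot_of_exists_lt ⟨s, hst⟩
  by_cases hy : ∃ l, Tendsto y (𝓝[<] t) (𝓝 l)
  · obtain ⟨l, hl⟩ := hy
    rw [leftLim_eq_of_tendsto hl]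
    refine ge_of_tendsto hl ?_
    filter_upwards [Ico_mem_nhdsLT hst] with r hr using h r ⟨hr.1, hr.2.le⟩
  · rw [leftLim_eq_of_not_tendsto y hy]
    exact h t ⟨hst.le, le_rfl⟩

/-- The size of the jump of the counting path `n` at time `r`. -/
noncomputable def jump (n : ℝ≥0 → ℕ) (r : ℝ≥0) : ℝ :=
  (n r : ℝ) - leftLim (fun r => (n r : ℝ)) r

variable {n : ℝ≥0 → ℕ} {u : ℝ≥0 → ℝ} {s t : ℝ≥0}

lemma monotone_cast (hn : Monotone n) : Monotone fun r => (n r : ℝ) :=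
  fun _ _ h => Nat.cast_le.2 (hn h)

lemma jump_nonneg (hn : Monotone n) (r : ℝ≥0) : 0 ≤ jump n r :=
  sub_nonneg.2 ((monotone_cast hn).leftLim_le le_rfl)

lemma jump_eq_zero (hn : Monotone n) {r : ℝ≥0} (hr : s < r) (h : n s = n r) : jump n r = 0 := by
  refine le_antisymm ?_ (jump_nonneg hn r)
  have := (monotone_cast hn).le_leftLim hr
  rw [jump, ← h]
  linarith

/-- The path takes distinct values, all at most `n t`, at distinct jump times. Finiteness matters
because a `finsum` over infinite support is `0` by convention and would not split. -/
lemma finite_jumps (hn : Monotone n) (t : ℝ≥0) : {r | r ≤ t ∧ 0 < r ∧ jump n r ≠ 0}.Finite := by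
  refine Set.Finite.of_finite_image (f := n) ((finite_Iic (n t)).subset ?_) ?_
  · rintro _ ⟨r, hr, rfl⟩
    exact hn hr.1
  · have key : ∀ a b : ℝ≥0, a < b → jump n b ≠ 0 → n a ≠ n b := fun a b hab hb h =>
      hb (jump_eq_zero hn hab h)
    intro a ha b hb hab
    rcases lt_trichotomy a b with h | h | h
    · exact absurd hab (key a b h hb.2.2)
    · exact h
    · exact absurd hab.symm (key b a h ha.2.2)

lemma countingIntegral_split (hn : Monotone n) (u : ℝ≥0 → ℝ) (hst : s ≤ t) :
    countingIntegral u n t = countingIntegral u n s + ∑ᶠ r ∈ Ioc s t, u r * jump n r := by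
  unfold countingIntegral
  rw [← Ioc_union_Ioc_eq_Ioc zero_le hst, finsum_mem_union' ?_ ?_ ?_]
  · rfl
  · rw [Set.disjoint_left]
    exact fun r h h' => not_lt.2 h.2 h'.1
  · refine (finite_jumps hn s).subset fun r hr => ⟨hr.1.2, hr.1.1, right_ne_zero_of_mul hr.2⟩
  · refine (finite_jumps hn t).subset fun r hr =>
      ⟨hr.1.2, hr.1.1.trans_le' zero_le, right_ne_zero_of_mul hr.2⟩

lemma countingIntegral_mono (hn : Monotone n) (hu : ∀ r, 0 ≤ u r) (hst : s ≤ t) :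
    countingIntegral u n s ≤ countingIntegral u n t := by
  rw [countingIntegral_split hn u hst]
  exact le_add_of_nonneg_right
    (finsum_mem_induction (0 ≤ ·) le_rfl (fun _ _ => add_nonneg)
      fun r _ => mul_nonneg (hu r) (jump_nonneg hn r))

lemma countingIntegral_eq (hn : Monotone n) (hst : s ≤ t) (h : n s = n t) :
    countingIntegral u n t = countingIntegral u n s := by
  rw [countingIntegral_split hn u hst, finsum_mem_eq_zero_of_forall_eq_zero, add_zero]
  intro r hr
  rw [jump_eq_zero hn hr.1 (le_antisymm (hn hr.1.le) ((hn hr.2).trans h.ge)), mul_zero]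

/-- A single arrival in `(s, t]` occurs at a time `r`, before which there is none. -/
lemma exists_arrival (hn : Monotone n) (hc : ∀ t, ContinuousWithinAt n (Ici t) t) (hst : s ≤ t)
    (h : n t = n s + 1) :
    ∃ r ∈ Ioc s t, (∀ v ∈ Ico s r, n v = n s) ∧
      countingIntegral u n t = countingIntegral u n s + u r := by
  set A := {v : ℝ≥0 | n s < n v} with hA
  have htA : t ∈ A := by simp [hA, h]
  set r := sInf A with hr
  have hbdd : BddBelow A := OrderBot.bddBelow A
  have hrt : r ≤ t := csInf_le hbdd htA
  have hsA : ∀ v ∈ A, s < v := fun v hv => lt_of_not_ge fun hvs => not_lt.2 (hn hvs) hv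
  have hsr : s ≤ r := le_csInf ⟨t, htA⟩ fun v hv => (hsA v hv).le
  -- Right continuity in a discrete space makes the path constant just after `r`, so the infimum is
  -- attained.
  have hrA : r ∈ A := by
    have hev : ∀ᶠ v in 𝓝[≥] r, n v = n r := by
      have := hc r
      rw [ContinuousWithinAt, nhds_discrete, tendsto_pure] at this
      exact this
    obtain ⟨b, hb, hb'⟩ : ∃ b, r < b ∧ ∀ v ∈ Ico r b, n v = n r := by
      obtain ⟨b, hb, hsub⟩ := (mem_nhdsGE_iff_exists_Ico_subset).1 hev
      exact ⟨b, hb, fun v hv => hsub hv⟩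
    obtain ⟨v, hvA, hvb⟩ := exists_lt_of_csInf_lt ⟨t, htA⟩ (hr ▸ hb)
    have : n v = n r := hb' v ⟨csInf_le hbdd hvA, hvb⟩
    change n s < n r
    rw [← this]
    exact hvA
  have hrs : s < r := hsA r hrA
  have hnr : n r = n s + 1 := le_antisymm (h ▸ hn hrt) hrA
  have hbefore : ∀ v ∈ Ico s r, n v = n s := fun v hv =>
    le_antisymm (not_lt.1 fun hlt => not_lt.2 (csInf_le hbdd hlt) hv.2) (hn hv.1)
  refine ⟨r, ⟨hrs, hrt⟩, hbefore, ?_⟩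
  have hjr : jump n r = 1 := by
    have hne : (𝓝[<] r).NeBot := nhdsLT_neBot_of_exists_lt ⟨s, hrs⟩
    have : leftLim (fun r => (n r : ℝ)) r = n s := by
      refine leftLim_eq_of_tendsto (tendsto_const_nhds.congr' ?_)
      filter_upwards [Ico_mem_nhdsLT hrs] with v hv
      rw [hbefore v hv]
    rw [jump, this, hnr]
    push_cast
    ring
  rw [countingIntegral_split hn u hst]
  congr 1
  have hz : ∀ v ∈ Ioc s t, v ≠ r → jump n v = 0 := by
    intro v hv hvr
    rcases lt_or_gt_of_ne hvr with hlt | hgt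
    · exact jump_eq_zero hn hv.1 (hbefore v ⟨hv.1.le, hlt⟩).symm
    · exact jump_eq_zero hn hgt (le_antisymm (hn hgt.le) ((hn hv.2).trans (by omega)))
  rw [finsum_mem_def, finsum_eq_single _ r]
  · rw [indicator_of_mem (show r ∈ Ioc s t from ⟨hrs, hrt⟩), hjr, mul_one]
  · intro v hv
    by_cases hm : v ∈ Ioc s t
    · rw [indicator_of_mem hm, hz v hm hv, mul_zero]
    · exact indicator_of_notMem hm _

end Paths

/-! ### Buffer paths over a short interval -/

section Buffer

lemma riskyPolicy_eq_one {T x : ℝ} (h0 : 0 < x) (hT : x < T) : riskyPolicy T x = 1 :=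
  indicator_of_mem (show x ∈ Ioo 0 T from ⟨h0, hT⟩) _

lemma riskyPolicy_eq_zero {T x : ℝ} (hT : T ≤ x) : riskyPolicy T x = 0 :=
  indicator_of_notMem (fun h => not_lt.2 hT h.2) _

lemma riskyPolicy_eq_zero_or_one (T x : ℝ) : riskyPolicy T x = 0 ∨ riskyPolicy T x = 1 := by
  by_cases h : x ∈ Ioo 0 T
  · exact Or.inr (indicator_of_mem h _)
  · exact Or.inl (indicator_of_notMem h _)

variable {n nc : ℝ≥0 → ℕ} {π : ℝ → ℕ} {D T : ℝ} {y : ℝ≥0 → ℝ} {s t : ℝ≥0}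

/-- The buffer path dynamics, for arrival paths `n` and `nc`. -/
structure IsBufferPath (n nc : ℝ≥0 → ℕ) (π : ℝ → ℕ) (D : ℝ) (y : ℝ≥0 → ℝ) : Prop where
  mono : Monotone n
  mono' : Monotone nc
  zero : n 0 = 0
  rightCont' : ∀ t, ContinuousWithinAt nc (Ici t) t
  dynamics : ∀ t, y t = D + n t + countingIntegral (fun s => (action π y s : ℝ)) nc t - t

namespace IsBufferPath

lemma initial (hy : IsBufferPath n nc π D y) : y 0 = D := by
  rw [hy.dynamics 0, hy.zero]
  simp [countingIntegral]

lemma sub_le (hy : IsBufferPath n nc π D y) (hst : s ≤ t) : y s - (t - s) ≤ y t := by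
  have h1 : (n s : ℝ) ≤ n t := Nat.cast_le.2 (hy.mono hst)
  have h2 := countingIntegral_mono (u := fun s => (action π y s : ℝ)) hy.mono'
    (fun r => Nat.cast_nonneg _) hst
  rw [hy.dynamics s, hy.dynamics t]
  linarith

lemma sub_le_leftLim (hy : IsBufferPath n nc π D y) (hst : s < t) :
    y s - (t - s) ≤ leftLim y t := by
  refine le_leftLim_of_forall hst fun r hr => le_trans ?_ (hy.sub_le hr.1)
  have : (r : ℝ) ≤ t := hr.2
  linarith

lemma eq_of_no_costly (hy : IsBufferPath n nc π D y) (hst : s ≤ t) (hc : nc t = nc s) :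
    y t = y s + ((n t : ℝ) - n s) - (t - s) := by
  have := countingIntegral_eq (u := fun s => (action π y s : ℝ)) hy.mono' hst hc.symm
  rw [hy.dynamics s, hy.dynamics t, this]
  ring

/-- With no free arrival the path is linear until the costly one. Here `l` is the left limit at that
arrival, which decides whether the arrival counts. -/
lemma eq_of_one_costly (hy : IsBufferPath n nc π D y) (hst : s ≤ t) (hn : n t = n s)
    (hc : nc t = nc s + 1) :
    ∃ l, y s - (t - s) ≤ l ∧ l < y s ∧ y t = y s + π l - (t - s) := by
  obtain ⟨r, hr, hbefore, hci⟩ := exists_arrival (u := fun s => (action π y s : ℝ)) hy.mono'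
    hy.rightCont' hst hc
  have hrt : (r : ℝ) ≤ t := hr.2
  have hsr : (s : ℝ) < r := hr.1
  have hl : leftLim y r = y s - (r - s) := by
    have hne : (𝓝[<] r).NeBot := nhdsLT_neBot_of_exists_lt ⟨s, hr.1⟩
    have hcont : Tendsto (fun v : ℝ≥0 => y s - ((v : ℝ) - s)) (𝓝[<] r) (𝓝 (y s - (r - s))) :=
      (Continuous.tendsto (by fun_prop) r).mono_left nhdsWithin_le_nhds
    refine leftLim_eq_of_tendsto (hcont.congr' ?_)
    filter_upwards [Ico_mem_nhdsLT hr.1] with v hv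
    have hnv : n v = n s :=
      le_antisymm ((hy.mono (hv.2.le.trans hr.2)).trans hn.le) (hy.mono hv.1)
    rw [hy.eq_of_no_costly hv.1 (hbefore v hv), hnv]
    ring
  refine ⟨leftLim y r, by rw [hl]; linarith, by rw [hl]; linarith, ?_⟩
  rw [hy.dynamics s, hy.dynamics t, hci, hn, action]
  ring

end IsBufferPath

lemma IsBufferProcess.isBufferPath {Ω : Type*} [MeasurableSpace Ω] {μ : Measure Ω} {R Rc : ℝ≥0}
    {N Nc : ℝ≥0 → Ω → ℕ} {x : ℝ≥0 → Ω → ℝ} (hN : IsPoissonProcess μ R N)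
    (hNc : IsPoissonProcess μ Rc Nc) (hx : IsBufferProcess N Nc π D x) (ω : Ω) :
    IsBufferPath (fun t => N t ω) (fun t => Nc t ω) π D (fun t => x t ω) where
  mono := hN.mono ω
  mono' := hNc.mono ω
  zero := hN.zero ω
  rightCont' := hNc.rightCont ω
  dynamics := hx.dynamics ω

end Buffer

/-! ### Independence of future arrivals from the past -/

section Independence

variable {Ω : Type*} [MeasurableSpace Ω] {μ : Measure Ω} {N Nc : ℝ≥0 → Ω → ℕ} {R Rc s t : ℝ≥0}

/-- Finitely many times in `[0, s]` are visited by a monotone sequence from `0` to `s`. -/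
lemma exists_monotone_times (I : Finset ℝ≥0) : ∀ s : ℝ≥0, (∀ i ∈ I, i ≤ s) →
    ∃ (n : ℕ) (τ : ℕ → ℝ≥0), Monotone τ ∧ τ 0 = 0 ∧ (∀ k, n ≤ k → τ k = s) ∧
      ∀ i ∈ I, ∃ k ≤ n, τ k = i := by
  induction I using Finset.induction_on_max with
  | empty =>
    intro s _
    refine ⟨1, fun k => if k = 0 then 0 else s, ?_, by simp, ?_, by simp⟩
    · intro a b hab
      by_cases ha : a = 0
      · simp [ha]
      · have hb : b ≠ 0 := by omega
        simp [ha, hb]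
    · intro k hk
      have : k ≠ 0 := by omega
      simp [this]
  | insert a I hI ih =>
    intro s hs
    obtain ⟨n, τ, hτ, h0, hn, hcov⟩ := ih a fun i hi => (hI i hi).le
    have has : a ≤ s := hs a (Finset.mem_insert_self a I)
    have hle : ∀ k, τ k ≤ a := fun k => by
      rcases le_total n k with h | h
      · exact (hn k h).le
      · exact (hτ h).trans (hn n le_rfl).le
    refine ⟨n + 1, fun k => if k ≤ n then τ k else s, ?_, by simp [h0], ?_, ?_⟩
    · intro j k hjk
      dsimp only
      split_ifs with h1 h2 h2
      · exact hτ hjk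
      · exact (hle j).trans has
      · omega
      · exact le_rfl
    · intro k hk
      have : ¬ k ≤ n := by omega
      simp [this]
    · intro i hi
      rcases Finset.mem_insert.1 hi with rfl | hi
      · exact ⟨n, by omega, by simp [hn n le_rfl]⟩
      · obtain ⟨k, hk, rfl⟩ := hcov i hi
        exact ⟨k, by omega, by simp [hk]⟩

lemma IsPoissonProcess.eval_eq_sum (hN : IsPoissonProcess μ R N) {τ : ℕ → ℝ≥0} (hτ : Monotone τ)
    (h0 : τ 0 = 0) (k : ℕ) (ω : Ω) :
    N (τ k) ω = ∑ i ∈ Finset.range k, (N (τ (i + 1)) ω - N (τ i) ω) := by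
  rw [Finset.sum_range_tsub (f := fun i => N (τ i) ω) (fun a b hab => hN.mono ω (hτ hab)), h0,
    hN.zero ω, tsub_zero]

/-- The past of a Poisson process is independent of its increments. -/
lemma IsPoissonProcess.indepFun_past [IsProbabilityMeasure μ] (hN : IsPoissonProcess μ R N)
    (hst : s ≤ t) :
    IndepFun (fun ω (r : Iic s) => N r ω) (fun ω => N t ω - N s ω) μ := by
  refine IndepFun.process_indepFun (X := fun (r : Iic s) ω => N r ω) (fun r => hN.measurable r)
    ((hN.measurable t).sub (hN.measurable s)) fun I => ?_
  obtain ⟨n, τ, hτ, h0, hn, hcov⟩ := exists_monotone_times (I.image Subtype.val) s (by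
    intro i hi
    obtain ⟨j, -, rfl⟩ := Finset.mem_image.1 hi
    exact j.2)
  have hle : ∀ k, τ k ≤ s := fun k => by
    rcases le_total n k with h | h
    · exact (hn k h).le
    · exact (hτ h).trans (hn n le_rfl).le
  -- Appending `t` after index `n` makes the `n`-th increment `N t - N s`, while the finitely many
  -- past values are sums of increments with smaller index.
  set σ : ℕ → ℝ≥0 := fun k => if k ≤ n then τ k else t with hσ
  have hσm : Monotone σ := by
    intro j k hjk
    simp only [hσ]
    split_ifs with h1 h2 h2
    · exact hτ hjk
    · exact (hle j).trans hst
    · omega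
    · exact le_rfl
  have hσ0 : σ 0 = 0 := by simp [hσ, h0]
  have hind := (hN.indepIncrements.nat hσm).indepFun_finset (Finset.range n) {n} (by simp)
    (fun i => (hN.measurable _).sub (hN.measurable _))
  choose k hk hkI using fun i : I => hcov i.1 (Finset.mem_image_of_mem _ i.2)
  have hσn : σ n = s := by simp [hσ, hn n le_rfl]
  have hσn1 : σ (n + 1) = t := by simp [hσ]
  have hψ : Measurable fun f : ({n} : Finset ℕ) → ℕ => f ⟨n, Finset.mem_singleton_self n⟩ :=
    measurable_pi_apply _
  have := hind.comp (φ := fun (f : Finset.range n → ℕ) (i : I) =>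
      ∑ j ∈ (Finset.range (k i)).attach,
        f ⟨j.1, Finset.range_mono (hk i) j.2⟩)
    (ψ := fun f : ({n} : Finset ℕ) → ℕ => f ⟨n, Finset.mem_singleton_self n⟩)
    (by fun_prop) hψ
  convert! this using 1
  · funext ω i
    have hσk : σ (k i) = i.1 := by simp [hσ, hk i, hkI i]
    have e := hN.eval_eq_sum hσm hσ0 (k i) ω
    rw [hσk] at e
    rw [e, ← Finset.sum_attach]
    rfl
  · funext ω
    simp [hσn, hσn1]

/-- If the pairs `(U, n)` and `(V, m)` are independent, `U` is independent of `n` and `V` is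
independent of `m`, then `(U, V)` is independent of `(n, m)`. -/
lemma indepFun_prodMk_prodMk {α β γ δ : Type*} [MeasurableSpace α] [MeasurableSpace β]
    [MeasurableSpace γ] [MeasurableSpace δ] [IsProbabilityMeasure μ] {U : Ω → α} {V : Ω → β}
    {n : Ω → γ} {m : Ω → δ} (hU : Measurable U) (hV : Measurable V) (hn : Measurable n)
    (hm : Measurable m) (h : IndepFun (fun ω => (U ω, n ω)) (fun ω => (V ω, m ω)) μ)
    (h1 : IndepFun U n μ) (h2 : IndepFun V m μ) :
    IndepFun (fun ω => (U ω, V ω)) (fun ω => (n ω, m ω)) μ := by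
  have hUV := h.comp measurable_fst measurable_fst
  have hnm := h.comp measurable_snd measurable_snd
  refine IndepSets.indep (hU.prodMk hV).comap_le (hn.prodMk hm).comap_le
    ((isPiSystem_prod (α := α) (β := β)).comap (fun ω => (U ω, V ω)))
    ((isPiSystem_prod (α := γ) (β := δ)).comap (fun ω => (n ω, m ω))) ?_ ?_ ?_
  · rw [← generateFrom_prod, MeasurableSpace.comap_generateFrom]
    rfl
  · rw [← generateFrom_prod, MeasurableSpace.comap_generateFrom]
    rfl
  rw [IndepSets_iff]
  rintro _ _ ⟨_, ⟨A, hA, B, hB, rfl⟩, rfl⟩ ⟨_, ⟨C, hC, E, hE, rfl⟩, rfl⟩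
  have e1 : (fun ω => (U ω, V ω)) ⁻¹' A ×ˢ B ∩ (fun ω => (n ω, m ω)) ⁻¹' C ×ˢ E =
      (fun ω => (U ω, n ω)) ⁻¹' (A ×ˢ C) ∩ (fun ω => (V ω, m ω)) ⁻¹' (B ×ˢ E) := by
    ext ω; simp only [mem_inter_iff, mem_preimage, mem_prod]; tauto
  have e2 : (fun ω => (U ω, V ω)) ⁻¹' A ×ˢ B = U ⁻¹' A ∩ V ⁻¹' B := rfl
  have e3 : (fun ω => (n ω, m ω)) ⁻¹' C ×ˢ E = n ⁻¹' C ∩ m ⁻¹' E := rfl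
  have e4 : (fun ω => (U ω, n ω)) ⁻¹' (A ×ˢ C) = U ⁻¹' A ∩ n ⁻¹' C := rfl
  have e5 : (fun ω => (V ω, m ω)) ⁻¹' (B ×ˢ E) = V ⁻¹' B ∩ m ⁻¹' E := rfl
  rw [e1, h.measure_inter_preimage_eq_mul _ _ (MeasurableSet.prod hA hC)
    (MeasurableSet.prod hB hE), e2, e3, e4, e5, h1.measure_inter_preimage_eq_mul _ _ hA hC,
    h2.measure_inter_preimage_eq_mul _ _ hB hE]
  have f1 : μ (U ⁻¹' A ∩ V ⁻¹' B) = μ (U ⁻¹' A) * μ (V ⁻¹' B) :=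
    hUV.measure_inter_preimage_eq_mul _ _ hA hB
  have f2 : μ (n ⁻¹' C ∩ m ⁻¹' E) = μ (n ⁻¹' C) * μ (m ⁻¹' E) :=
    hnm.measure_inter_preimage_eq_mul _ _ hC hE
  rw [f1, f2]
  ring

lemma arrivalHistory_le (hN : ∀ t, Measurable (N t)) (hNc : ∀ t, Measurable (Nc t)) (s : ℝ≥0) :
    arrivalHistory N Nc s ≤ ‹MeasurableSpace Ω› :=
  iSup₂_le fun r _ => sup_le (hN r).comap_le (hNc r).comap_le

lemma arrivalHistory_mono {Ω : Type*} {N Nc : ℝ≥0 → Ω → ℕ} {s t : ℝ≥0} (hst : s ≤ t) :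
    arrivalHistory N Nc s ≤ arrivalHistory N Nc t :=
  biSup_mono fun _ hr => le_trans hr hst

/-- The arrivals in `(s, t]` are independent of the arrivals up to time `s`. -/
lemma indep_arrivalHistory [IsProbabilityMeasure μ] (hN : IsPoissonProcess μ R N)
    (hNc : IsPoissonProcess μ Rc Nc) (hindep : IndepFun (fun ω t => N t ω) (fun ω t => Nc t ω) μ)
    (hst : s ≤ t) :
    Indep (arrivalHistory N Nc s)
      (MeasurableSpace.comap (fun ω => (N t ω - N s ω, Nc t ω - Nc s ω)) inferInstance) μ := by
  have key := indepFun_prodMk_prodMk (μ := μ)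
    (U := fun ω (r : Iic s) => N r ω) (V := fun ω (r : Iic s) => Nc r ω)
    (n := fun ω => N t ω - N s ω) (m := fun ω => Nc t ω - Nc s ω)
    (measurable_pi_lambda _ fun r => hN.measurable r)
    (measurable_pi_lambda _ fun r => hNc.measurable r)
    ((hN.measurable t).sub (hN.measurable s)) ((hNc.measurable t).sub (hNc.measurable s))
    (hindep.comp (φ := fun f : ℝ≥0 → ℕ => ((fun r : Iic s => f r), f t - f s))
      (ψ := fun f : ℝ≥0 → ℕ => ((fun r : Iic s => f r), f t - f s))
      (by fun_prop) (by fun_prop))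
    (hN.indepFun_past hst) (hNc.indepFun_past hst)
  refine indep_of_indep_of_le_left key (iSup₂_le fun r hr => sup_le ?_ ?_)
  · rw [← measurable_iff_comap_le]
    have h := comap_measurable (m := inferInstance)
      (fun ω => ((fun r : Iic s => N r ω), (fun r : Iic s => Nc r ω)))
    exact (measurable_pi_apply (⟨r, hr⟩ : Iic s)).comp (measurable_fst.comp h)
  · rw [← measurable_iff_comap_le]
    have h := comap_measurable (m := inferInstance)
      (fun ω => ((fun r : Iic s => N r ω), (fun r : Iic s => Nc r ω)))
    exact (measurable_pi_apply (⟨r, hr⟩ : Iic s)).comp (measurable_snd.comp h)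

lemma IsPoissonProcess.prob_increment (hN : IsPoissonProcess μ R N) (hst : s ≤ t) (i : ℕ) :
    μ.real ((fun ω => N t ω - N s ω) ⁻¹' {i}) =
      Real.exp (-(R * (t - s) : ℝ)) * (R * (t - s) : ℝ) ^ i / i.factorial := by
  have h := hN.law s t hst
  have hm : Measurable fun ω => N t ω - N s ω := (hN.measurable t).sub (hN.measurable s)
  rw [← map_measureReal_apply hm (measurableSet_singleton i), h.map_eq, poissonMeasure_real_singleton,
    NNReal.coe_mul, NNReal.coe_sub hst]

/-- The probability of `i` free arrivals and `j` costly arrivals in `(s, t]`, given the past. -/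
lemma integral_mul_increments [IsProbabilityMeasure μ] (hN : IsPoissonProcess μ R N)
    (hNc : IsPoissonProcess μ Rc Nc) (hindep : IndepFun (fun ω t => N t ω) (fun ω t => Nc t ω) μ)
    (hst : s ≤ t) {Y : Ω → ℝ} (hY : Measurable[arrivalHistory N Nc s] Y) (i j : ℕ) :
    ∫ ω, Y ω * ({ω | N t ω - N s ω = i ∧ Nc t ω - Nc s ω = j}.indicator 1 ω) ∂μ =
      (∫ ω, Y ω ∂μ) *
        ((Real.exp (-(R * (t - s) : ℝ)) * (R * (t - s) : ℝ) ^ i / i.factorial) *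
          (Real.exp (-(Rc * (t - s) : ℝ)) * (Rc * (t - s) : ℝ) ^ j / j.factorial)) := by
  have hind := indep_arrivalHistory hN hNc hindep hst
  have hmN : Measurable fun ω => N t ω - N s ω := (hN.measurable t).sub (hN.measurable s)
  have hmNc : Measurable fun ω => Nc t ω - Nc s ω := (hNc.measurable t).sub (hNc.measurable s)
  set S := {ω | N t ω - N s ω = i ∧ Nc t ω - Nc s ω = j} with hS
  have hSpre : S = (fun ω => (N t ω - N s ω, Nc t ω - Nc s ω)) ⁻¹' {(i, j)} := by
    ext ω; simp [hS]
  have hSm' : MeasurableSet[MeasurableSpace.comap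
      (fun ω => (N t ω - N s ω, Nc t ω - Nc s ω)) inferInstance] S :=
    ⟨{(i, j)}, measurableSet_singleton _, hSpre.symm⟩
  have hSm : MeasurableSet S := hSpre ▸ (hmN.prodMk hmNc) (measurableSet_singleton _)
  have hYS : IndepFun Y (S.indicator (1 : Ω → ℝ)) μ :=
    indep_of_indep_of_le hind (measurable_iff_comap_le.1 hY)
      (measurable_iff_comap_le.1
        (Measurable.indicator (@measurable_const _ _ _ (MeasurableSpace.comap _ _) 1) hSm'))
  rw [hYS.integral_fun_mul_eq_mul_integral
    (hY.mono (arrivalHistory_le hN.measurable hNc.measurable s) le_rfl).aestronglyMeasurable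
    (measurable_one.indicator hSm).aestronglyMeasurable, integral_indicator_one hSm]
  congr 1
  have hinc : IndepFun (fun ω => N t ω - N s ω) (fun ω => Nc t ω - Nc s ω) μ :=
    hindep.comp (φ := fun f : ℝ≥0 → ℕ => f t - f s) (ψ := fun f : ℝ≥0 → ℕ => f t - f s)
      (by fun_prop) (by fun_prop)
  rw [← hN.prob_increment hst i, ← hNc.prob_increment hst j]
  have : S = (fun ω => N t ω - N s ω) ⁻¹' {i} ∩ (fun ω => Nc t ω - Nc s ω) ⁻¹' {j} := rfl
  rw [this, measureReal_def, hinc.measure_inter_preimage_eq_mul _ _ (measurableSet_singleton _)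
    (measurableSet_singleton _), ENNReal.toReal_mul]
  rfl

end Independence

/-! ### One grid step, pathwise and in mean -/

section Step

variable {R₀ Rc T κ h₀ C h θ x : ℝ} {F : ℝ → ℝ}

/-- The value `F`, raised by `h` above the threshold `T`: this pays for the costly server during the
grid step in which the buffer falls below `T`. -/
noncomputable def lifted (T h : ℝ) (F : ℝ → ℝ) (x : ℝ) : ℝ := F x + (Ici T).indicator (fun _ => h) x

/-- The value after an arrival from the costly server, which is effective below `T`. -/
noncomputable def arrivalValue (T : ℝ) (F : ℝ → ℝ) (x : ℝ) : ℝ := if x < T then F (x + 1) else F x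

lemma lifted_le (hh : 0 ≤ h) : lifted T h F x ≤ F x + h := by
  unfold lifted
  by_cases hx : x ∈ Ici T
  · rw [indicator_of_mem hx]
  · rw [indicator_of_notMem hx]; linarith

lemma le_lifted (hh : 0 ≤ h) : F x ≤ lifted T h F x := by
  unfold lifted
  by_cases hx : x ∈ Ici T
  · rw [indicator_of_mem hx]; linarith
  · rw [indicator_of_notMem hx]; linarith

namespace IsSupersolution

variable (hF : IsSupersolution R₀ Rc T κ h₀ C F)
include hF

lemma measurable_lifted : Measurable (lifted T h F) :=
  hF.continuous.measurable.add (measurable_const.indicator measurableSet_Ici)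

lemma measurable_arrivalValue : Measurable (arrivalValue T F) :=
  Measurable.ite measurableSet_Iio (hF.continuous.measurable.comp (measurable_id.add_const 1))
    hF.continuous.measurable

lemma abs_le (hx : -1 ≤ x) : |F x| ≤ C := by
  refine _root_.abs_le.2 ⟨?_, hF.le_C x hx⟩
  rcases le_total 0 x with h | h
  · linarith [hF.nonneg x h, hF.C_nonneg]
  · have h1 := hF.lipschitz 0 x (by norm_num) hx
    have h2 := hF.nonneg 0 le_rfl
    have h3 : C * |0 - x| ≤ C * 1 := by
      refine mul_le_mul_of_nonneg_left ?_ hF.C_nonneg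
      rw [_root_.abs_le]
      constructor <;> linarith
    linarith

lemma abs_lifted_le (hh : 0 ≤ h) (hh1 : h ≤ 1) (hx : -1 ≤ x) : |lifted T h F x| ≤ C + 1 := by
  have h1 := lifted_le (T := T) (F := F) (x := x) hh
  have h2 := le_lifted (T := T) (F := F) (x := x) hh
  have h3 := _root_.abs_le.1 (hF.abs_le hx)
  exact _root_.abs_le.2 ⟨by linarith, by linarith⟩

lemma abs_arrivalValue_le (hx : -1 ≤ x) : |arrivalValue T F x| ≤ C := by
  unfold arrivalValue
  split_ifs
  · exact hF.abs_le (by linarith)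
  · exact hF.abs_le hx

lemma arrival_le {y : ℝ} (hx : -1 ≤ x) (hh : 0 ≤ h) (hy : -1 ≤ y) (hxy : |x - y| ≤ h) :
    lifted T h F x ≤ F y + (C + 1) * h := by
  have h1 := lifted_le (T := T) (F := F) (x := x) hh
  have h2 := hF.lipschitz x y hx hy
  have h3 := mul_le_mul_of_nonneg_left hxy hF.C_nonneg
  linarith

/-- One step of the grid in expectation, for the three most likely numbers of arrivals. -/
lemma step_bound (hR₀ : 0 ≤ R₀) (hRc : 0 ≤ Rc) (hκ0 : 0 ≤ κ) (hκ1 : κ ≤ 1) (hh : 0 < h)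
    (hh₀ : h ≤ h₀) (hx : 0 < x) :
    Real.exp (-(R₀ * h)) * Real.exp (-(Rc * h)) * (lifted T h F (x - h) - (C + 1)) +
      Real.exp (-(R₀ * h)) * (R₀ * h) * Real.exp (-(Rc * h)) *
        (F (x + 1) + (2 * C + 1) * h - (C + 1)) +
      Real.exp (-(R₀ * h)) * (Real.exp (-(Rc * h)) * (Rc * h)) *
        (arrivalValue T F x + (2 * C + 1) * h - (C + 1)) ≤
    lifted T h F x - (C + 1) - (Iio (T + h)).indicator (fun _ => κ * h) x +
      (κ * (R₀ + Rc) + C + (R₀ + Rc) * (2 * C + 1) + (C + 1) * (R₀ + Rc) ^ 2) * h ^ 2 := by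
  have hexp : Real.exp (-(R₀ * h)) * Real.exp (-(Rc * h)) = Real.exp (-((R₀ + Rc) * h)) := by
    rw [← Real.exp_add]; ring_nf
  set e := Real.exp (-((R₀ + Rc) * h)) with he
  have hr0 : 0 ≤ (R₀ + Rc) * h := by positivity
  have he0 : 0 ≤ e := (Real.exp_pos _).le
  have he1 : e ≤ 1 := Real.exp_le_one_iff.2 (by linarith)
  have he2 : 1 - (R₀ + Rc) * h ≤ e := by
    have := Real.add_one_le_exp (-((R₀ + Rc) * h)); linarith
  have he3 : e * (1 + (R₀ + Rc) * h) ≤ 1 := by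
    have h1 : e * (1 + (R₀ + Rc) * h) ≤ e * Real.exp ((R₀ + Rc) * h) :=
      mul_le_mul_of_nonneg_left (by linarith [Real.add_one_le_exp ((R₀ + Rc) * h)]) he0
    rwa [he, ← Real.exp_add, neg_add_cancel, Real.exp_zero] at h1
  have hFx : 0 ≤ F x := hF.nonneg x hx.le
  have hC := hF.C_nonneg
  have hV : e * (lifted T h F (x - h)) ≤
      e * F (x - h) + (Ici T).indicator (fun _ => h) (x - h) := by
    rw [lifted, mul_add]
    have : e * (Ici T).indicator (fun _ => h) (x - h) ≤ (Ici T).indicator (fun _ => h) (x - h) :=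
      mul_le_of_le_one_left (indicator_nonneg (fun _ _ => hh.le) _) he1
    linarith
  have hmain : e * (F (x - h) + R₀ * h * F (x + 1) + Rc * h * arrivalValue T F x) ≤
      F x - (Iio T).indicator (fun _ => κ * h) x + (κ * (R₀ + Rc) + C) * h ^ 2 := by
    have hx1 : e * (F x * (1 + (R₀ + Rc) * h)) ≤ F x := by
      have := mul_le_mul_of_nonneg_right he3 hFx
      linarith
    have hCe : e * (C * h ^ 2) ≤ C * h ^ 2 := mul_le_of_le_one_left (by positivity) he1
    have hκe : e * (κ * h) ≥ κ * h - κ * (R₀ + Rc) * h ^ 2 := by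
      have := mul_le_mul_of_nonneg_right he2 (mul_nonneg hκ0 hh.le)
      nlinarith
    by_cases hxT : x < T
    · have hb := hF.below h hh hh₀ x hx hxT
      rw [indicator_of_mem (show x ∈ Iio T from hxT), arrivalValue, if_pos hxT]
      have : F (x - h) + R₀ * h * F (x + 1) + Rc * h * F (x + 1) ≤
          F x * (1 + (R₀ + Rc) * h) - κ * h + C * h ^ 2 := by linarith
      have := mul_le_mul_of_nonneg_left this he0
      linarith
    · have hb := hF.above h hh hh₀ x (not_lt.1 hxT)
      rw [indicator_of_notMem (show x ∉ Iio T from hxT), arrivalValue, if_neg hxT]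
      have : F (x - h) + R₀ * h * F (x + 1) + Rc * h * F x ≤
          F x * (1 + (R₀ + Rc) * h) + C * h ^ 2 := by linarith
      have h1 := mul_le_mul_of_nonneg_left this he0
      have : 0 ≤ κ * (R₀ + Rc) * h ^ 2 := by positivity
      linarith
  -- For `T ≤ x < T + h` no drift `-κ` is available at `x`, but the lift `h` is lost on falling
  -- below `T`; as `κ ≤ 1`, it covers the charge `κ h`.
  have hind : (Ici T).indicator (fun _ => h) (x - h) - (Iio T).indicator (fun _ => κ * h) x ≤
      (Ici T).indicator (fun _ => h) x - (Iio (T + h)).indicator (fun _ => κ * h) x := by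
    have hκh : κ * h ≤ h := mul_le_of_le_one_left hh.le hκ1
    simp only [indicator, mem_Ici, mem_Iio]
    split_ifs <;> linarith
  have herr : e * ((R₀ * h + Rc * h) * ((2 * C + 1) * h)) ≤ (R₀ + Rc) * (2 * C + 1) * h ^ 2 := by
    have : e * ((R₀ * h + Rc * h) * ((2 * C + 1) * h)) ≤
        (R₀ * h + Rc * h) * ((2 * C + 1) * h) := mul_le_of_le_one_left (by positivity) he1
    linarith
  -- Two or more arrivals have probability `1 - e (1 + (R₀ + Rc) h)`, which is of second order.
  have hK : (C + 1) * (1 - e * (1 + (R₀ + Rc) * h)) ≤ (C + 1) * (R₀ + Rc) ^ 2 * h ^ 2 := by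
    have h1 : (1 - (R₀ + Rc) * h) * (1 + (R₀ + Rc) * h) ≤ e * (1 + (R₀ + Rc) * h) :=
      mul_le_mul_of_nonneg_right he2 (by linarith)
    have h2 : 1 - e * (1 + (R₀ + Rc) * h) ≤ (R₀ + Rc) ^ 2 * h ^ 2 := by linarith
    have := mul_le_mul_of_nonneg_left h2 (by linarith : 0 ≤ C + 1)
    linarith
  have expand : Real.exp (-(R₀ * h)) * Real.exp (-(Rc * h)) * (lifted T h F (x - h) - (C + 1)) +
      Real.exp (-(R₀ * h)) * (R₀ * h) * Real.exp (-(Rc * h)) *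
        (F (x + 1) + (2 * C + 1) * h - (C + 1)) +
      Real.exp (-(R₀ * h)) * (Real.exp (-(Rc * h)) * (Rc * h)) *
        (arrivalValue T F x + (2 * C + 1) * h - (C + 1)) =
      e * lifted T h F (x - h) + e * (R₀ * h * F (x + 1) + Rc * h * arrivalValue T F x) +
        e * ((R₀ * h + Rc * h) * ((2 * C + 1) * h)) - (C + 1) * (e * (1 + (R₀ + Rc) * h)) := by
    rw [← hexp]; ring
  rw [expand, lifted.eq_def T h F x]
  linarith

variable {n nc : ℝ≥0 → ℕ} {D : ℝ} {y : ℝ≥0 → ℝ} {s t : ℝ≥0}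

lemma lifted_of_free_arrival (hy : IsBufferPath n nc (riskyPolicy T) D y) (hst : s ≤ t)
    (hh : (t : ℝ) - s = h) (hh0 : 0 ≤ h) (hh1 : h ≤ 1) (hx : 0 < y s) (hn : n t = n s + 1)
    (hc : nc t = nc s) : lifted T h F (y t) ≤ F (y s + 1) + (2 * C + 1) * h := by
  have hyt : y t = y s + 1 - h := by
    rw [hy.eq_of_no_costly hst hc, hn, hh]; push_cast; ring
  have := hF.arrival_le (x := y t) (y := y s + 1) (by linarith) hh0 (by linarith)
    (by rw [hyt, _root_.abs_le]; constructor <;> linarith)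
  have := mul_nonneg hF.C_nonneg hh0
  linarith

/-- The action at the arrival may differ from the action at the start of the step in two ways. The
buffer may have emptied, which is excluded when `θ = h` and harmless when `F 0 ≤ F 1`; or it may
have dropped below `T`, where `F (T + 1) ≤ F T` is used. -/
lemma lifted_of_costly_arrival (hT : 0 ≤ T) (hy : IsBufferPath n nc (riskyPolicy T) D y)
    (hst : s ≤ t) (hh : (t : ℝ) - s = h) (hh0 : 0 ≤ h) (hh1 : h ≤ 1) (hθ0 : 0 ≤ θ) (hx : θ < y s)
    (hθ : θ = h ∨ F 0 ≤ F 1) (hn : n t = n s) (hc : nc t = nc s + 1) :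
    lifted T h F (y t) ≤ arrivalValue T F (y s) + (2 * C + 1) * h := by
  obtain ⟨l, hl1, hl2, hyt⟩ := hy.eq_of_one_costly hst hn hc
  rw [hh] at hl1 hyt
  have hCh := mul_nonneg hF.C_nonneg hh0
  rcases riskyPolicy_eq_zero_or_one T l with h0 | h1
  · rw [h0, Nat.cast_zero, add_zero] at hyt
    by_cases hxT : y s < T
    · rw [arrivalValue, if_pos hxT]
      have hl0 : l ≤ 0 := by
        by_contra! hl0
        rw [riskyPolicy_eq_one hl0 (hl2.trans hxT)] at h0
        exact one_ne_zero h0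
      have h01 : F 0 ≤ F 1 := by
        refine hθ.resolve_left fun hθh => ?_
        linarith
      have e1 := hF.arrival_le (x := y t) (y := 0) (by linarith) hh0 (by norm_num)
        (by rw [hyt, _root_.abs_le]; constructor <;> linarith)
      have e2 := hF.lipschitz 1 (y s + 1) (by norm_num) (by linarith)
      have e3 : C * |1 - (y s + 1)| ≤ C * h := by
        refine mul_le_mul_of_nonneg_left ?_ hF.C_nonneg
        rw [_root_.abs_le]; constructor <;> linarith
      linarith
    · rw [arrivalValue, if_neg hxT]
      have e1 := hF.arrival_le (x := y t) (y := y s) (by linarith) hh0 (by linarith)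
        (by rw [hyt, _root_.abs_le]; constructor <;> linarith)
      linarith
  · rw [h1, Nat.cast_one] at hyt
    by_cases hxT : y s < T
    · rw [arrivalValue, if_pos hxT]
      have e1 := hF.arrival_le (x := y t) (y := y s + 1) (by linarith) hh0 (by linarith)
        (by rw [hyt, _root_.abs_le]; constructor <;> linarith)
      linarith
    · rw [arrivalValue, if_neg hxT]
      push Not at hxT
      have hlT : l < T := by
        by_contra! hlT
        rw [riskyPolicy_eq_zero hlT] at h1
        exact zero_ne_one h1
      have e1 := hF.arrival_le (x := y t) (y := T + 1) (by linarith) hh0 (by linarith)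
        (by rw [hyt, _root_.abs_le]; constructor <;> linarith)
      have e2 := hF.jump_le
      have e3 := hF.lipschitz T (y s) (by linarith) (by linarith)
      have e4 : C * |T - y s| ≤ C * h := by
        refine mul_le_mul_of_nonneg_left ?_ hF.C_nonneg
        rw [_root_.abs_le]; constructor <;> linarith
      linarith

end IsSupersolution

end Step

/-! ### Dynkin's inequality on a time grid -/

section Drift

variable {Ω : Type*} [MeasurableSpace Ω] {μ : Measure Ω} [IsProbabilityMeasure μ]
  {N Nc : ℝ≥0 → Ω → ℕ} {R₀ Rc s t : ℝ≥0} {T D κ h₀ C h θ : ℝ} {F : ℝ → ℝ} {x : ℝ≥0 → Ω → ℝ}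

lemma integrable_indicator_comp {X : Ω → ℝ} {B : Set Ω} {φ : ℝ → ℝ} {M : ℝ} (hX : Measurable X)
    (hB : MeasurableSet B) (hφ : Measurable φ) (hM : ∀ ω ∈ B, |φ (X ω)| ≤ M) :
    Integrable (B.indicator fun ω => φ (X ω)) μ := by
  refine Integrable.of_bound ((hφ.comp hX).indicator hB).aestronglyMeasurable (|M|)
    (ae_of_all _ fun ω => ?_)
  by_cases hω : ω ∈ B
  · rw [indicator_of_mem hω]
    exact (hM ω hω).trans (le_abs_self M)
  · rw [indicator_of_notMem hω, norm_zero]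
    exact abs_nonneg M

/-- The expected change of the lifted supersolution over one step of the grid. -/
lemma integral_step_le (hN : IsPoissonProcess μ R₀ N) (hNc : IsPoissonProcess μ Rc Nc)
    (hindep : IndepFun (fun ω t => N t ω) (fun ω t => Nc t ω) μ)
    (hx : IsBufferProcess N Nc (riskyPolicy T) D x)
    (hF : IsSupersolution R₀ Rc T κ h₀ C F) (hT : 0 ≤ T) (hκ0 : 0 ≤ κ) (hκ1 : κ ≤ 1)
    (hst : s ≤ t) (hh : (t : ℝ) - s = h) (hh0 : 0 < h) (hh₀ : h ≤ h₀) (hh1 : h ≤ 1)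
    (hθ0 : 0 ≤ θ) (hθ : θ = h ∨ F 0 ≤ F 1) {B : Set Ω}
    (hB : MeasurableSet[arrivalHistory N Nc s] B) (hBθ : ∀ ω ∈ B, θ < x s ω) :
    ∫ ω, B.indicator (fun ω => lifted T h F (x t ω)) ω ∂μ ≤
      ∫ ω, B.indicator (fun ω => lifted T h F (x s ω)) ω ∂μ -
        κ * h * μ.real (B ∩ {ω | x s ω < T + h}) +
      (κ * (R₀ + Rc) + C + (R₀ + Rc) * (2 * C + 1) + (C + 1) * (R₀ + Rc) ^ 2) * h ^ 2 := by
  have hle := arrivalHistory_le hN.measurable hNc.measurable s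
  have hXs : Measurable (x s) := (hx.adapted s).mono hle le_rfl
  have hXt : Measurable (x t) :=
    (hx.adapted t).mono (arrivalHistory_le hN.measurable hNc.measurable t) le_rfl
  have hBm : MeasurableSet B := hle B hB
  have hC := hF.C_nonneg
  have hpos : ∀ ω ∈ B, 0 < x s ω := fun ω hω => hθ0.trans_lt (hBθ ω hω)
  have hxt : ∀ ω ∈ B, -1 ≤ x t ω := fun ω hω => by
    have h1 := (hx.isBufferPath hN hNc ω).sub_le hst
    have h2 := hpos ω hω
    linarith
  set E : ℕ → ℕ → Set Ω := fun i j => {ω | N t ω - N s ω = i ∧ Nc t ω - Nc s ω = j} with hE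
  have hEm : ∀ i j, MeasurableSet (E i j) := fun i j =>
    (((hN.measurable t).sub (hN.measurable s)) (measurableSet_singleton i)).inter
      (((hNc.measurable t).sub (hNc.measurable s)) (measurableSet_singleton j))
  set φ : ℕ → ℕ → ℝ → ℝ := fun i j y =>
    if i = 0 ∧ j = 0 then lifted T h F (y - h) - (C + 1)
    else if j = 0 then F (y + 1) + (2 * C + 1) * h - (C + 1)
    else arrivalValue T F y + (2 * C + 1) * h - (C + 1) with hφ
  have hφm : ∀ i j, Measurable (φ i j) := by
    intro i j
    simp only [hφ]
    split_ifs
    · exact (hF.measurable_lifted.comp (measurable_id.sub_const h)).sub_const _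
    · exact ((hF.continuous.measurable.comp (measurable_id.add_const 1)).add_const _).sub_const _
    · exact (hF.measurable_arrivalValue.add_const _).sub_const _
  have hφb : ∀ i j, ∀ y, 0 < y → |φ i j y| ≤ 4 * C + 3 := by
    intro i j y hy
    have hCh : (2 * C + 1) * h ≤ 2 * C + 1 := mul_le_of_le_one_right (by linarith) hh1
    have hCh0 : 0 ≤ (2 * C + 1) * h := by positivity
    simp only [hφ]
    split_ifs
    · have := abs_le.1 (hF.abs_lifted_le hh0.le hh1 (by linarith : -1 ≤ y - h))
      exact abs_le.2 ⟨by linarith, by linarith⟩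
    · have := abs_le.1 (hF.abs_le (by linarith : -1 ≤ y + 1))
      exact abs_le.2 ⟨by linarith, by linarith⟩
    · have := abs_le.1 (hF.abs_arrivalValue_le (by linarith : -1 ≤ y))
      exact abs_le.2 ⟨by linarith, by linarith⟩
  set Y : ℕ → ℕ → Ω → ℝ := fun i j => B.indicator fun ω => φ i j (x s ω) with hY
  have hYm : ∀ i j, Measurable[arrivalHistory N Nc s] (Y i j) := fun i j =>
    Measurable.indicator ((hφm i j).comp (hx.adapted s)) hB
  have hYi : ∀ i j, Integrable (Y i j) μ := fun i j =>
    integrable_indicator_comp hXs hBm (hφm i j) fun ω hω => hφb i j _ (hpos ω hω)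
  have hYE : ∀ i j, Integrable (fun ω => Y i j ω * (E i j).indicator 1 ω) μ := fun i j => by
    have : (fun ω => Y i j ω * (E i j).indicator 1 ω) = (E i j).indicator (Y i j) := by
      funext ω
      by_cases hω : ω ∈ E i j <;> simp [hω]
    rw [this]
    exact (hYi i j).indicator (hEm i j)
  have hVi : ∀ r : ℝ≥0, Measurable (x r) → (∀ ω ∈ B, -1 ≤ x r ω) →
      Integrable (B.indicator fun ω => lifted T h F (x r ω)) μ := fun r hr hr1 =>
    integrable_indicator_comp hr hBm hF.measurable_lifted fun ω hω =>
      hF.abs_lifted_le hh0.le hh1 (hr1 ω hω)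
  have hVt := hVi t hXt hxt
  have hVs := hVi s hXs fun ω hω => by linarith [hpos ω hω]
  have hKi : Integrable (B.indicator fun _ => C + 1) μ := (integrable_const _).indicator hBm
  -- After subtraction of the upper bound `C + 1` the left side is nonpositive, so every outcome
  -- with two or more arrivals can be discarded.
  have hpath : ∀ ω, B.indicator (fun ω => lifted T h F (x t ω)) ω -
      B.indicator (fun _ => C + 1) ω ≤
      Y 0 0 ω * (E 0 0).indicator 1 ω + Y 1 0 ω * (E 1 0).indicator 1 ω +
        Y 0 1 ω * (E 0 1).indicator 1 ω := by
    intro ω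
    by_cases hω : ω ∈ B
    swap
    · simp [hY, hω]
    have hp := hx.isBufferPath hN hNc ω
    have hn : N s ω ≤ N t ω := hp.mono hst
    have hnc : Nc s ω ≤ Nc t ω := hp.mono' hst
    simp only [hY, indicator_of_mem hω]
    by_cases h00 : ω ∈ E 0 0
    · have e1 : ω ∉ E 1 0 := fun h' => by simp [hE] at h' h00; omega
      have e2 : ω ∉ E 0 1 := fun h' => by simp [hE] at h' h00; omega
      have hv : x t ω = x s ω - h := by
        have := hp.eq_of_no_costly hst (by have := h00.2; omega)
        have hn0 : N t ω = N s ω := by have := h00.1; omega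
        simp only [hn0, sub_self, add_zero, hh] at this
        exact this
      simp [h00, e1, e2, hφ, hv]
    by_cases h10 : ω ∈ E 1 0
    · have e2 : ω ∉ E 0 1 := fun h' => by simp [hE] at h' h10; omega
      have hv := hF.lifted_of_free_arrival hp hst hh hh0.le hh1 (hpos ω hω)
        (by have := h10.1; omega) (by have := h10.2; omega)
      simp only [h00, h10, e2, hφ, not_false_eq_true, indicator_of_notMem, indicator_of_mem,
        Pi.one_apply]
      norm_num
      linarith
    by_cases h01 : ω ∈ E 0 1
    · have hv := hF.lifted_of_costly_arrival hT hp hst hh hh0.le hh1 hθ0 (hBθ ω hω) hθ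
        (by have := h01.1; omega) (by have := h01.2; omega)
      simp only [h00, h10, h01, hφ, not_false_eq_true, indicator_of_notMem, indicator_of_mem,
        Pi.one_apply]
      norm_num
      linarith
    · have := (abs_le.1 (hF.abs_lifted_le hh0.le hh1 (hxt ω hω))).2
      simp only [h00, h10, h01, not_false_eq_true, indicator_of_notMem]
      linarith
  have hI := integral_mono (hVt.sub hKi) (((hYE 0 0).add (hYE 1 0)).add (hYE 0 1)) hpath
  have hI' : ∫ ω, B.indicator (fun ω => lifted T h F (x t ω)) ω ∂μ -
      ∫ ω, B.indicator (fun _ => C + 1) ω ∂μ ≤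
      Real.exp (-(R₀ * h)) * Real.exp (-(Rc * h)) * ∫ ω, Y 0 0 ω ∂μ +
      Real.exp (-(R₀ * h)) * (R₀ * h) * Real.exp (-(Rc * h)) * ∫ ω, Y 1 0 ω ∂μ +
      Real.exp (-(R₀ * h)) * (Real.exp (-(Rc * h)) * (Rc * h)) * ∫ ω, Y 0 1 ω ∂μ := by
    have e := fun i j => integral_mul_increments hN hNc hindep hst (hYm i j) i j
    have e00 := e 0 0
    have e10 := e 1 0
    have e01 := e 0 1
    simp only [hh, pow_zero, pow_one, Nat.factorial_zero, Nat.factorial_one, Nat.cast_one, mul_one,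
      div_one] at e00 e10 e01
    rw [← integral_sub hVt hKi]
    refine hI.trans (le_of_eq ?_)
    have a1 := integral_add ((hYE 0 0).add (hYE 1 0)) (hYE 0 1)
    have a2 := integral_add (hYE 0 0) (hYE 1 0)
    simp only [Pi.add_apply] at a1 a2 ⊢
    rw [a1, a2]
    simp only [hE] at e00 e10 e01 ⊢
    rw [e00, e10, e01]
    ring
  set Q := κ * (R₀ + Rc) + C + (R₀ + Rc) * (2 * C + 1) + (C + 1) * ((R₀ : ℝ) + Rc) ^ 2 with hQ
  have hQ0 : 0 ≤ Q := by positivity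
  set Z := B ∩ {ω | x s ω < T + h} with hZ
  have hZm : MeasurableSet Z := hBm.inter (measurableSet_lt hXs measurable_const)
  have hZi : Integrable (Z.indicator fun _ => κ * h) μ := (integrable_const _).indicator hZm
  have hQi : Integrable (B.indicator fun _ => Q * h ^ 2) μ := (integrable_const _).indicator hBm
  have hJ : Real.exp (-(R₀ * h)) * Real.exp (-(Rc * h)) * ∫ ω, Y 0 0 ω ∂μ +
      Real.exp (-(R₀ * h)) * (R₀ * h) * Real.exp (-(Rc * h)) * ∫ ω, Y 1 0 ω ∂μ +
      Real.exp (-(R₀ * h)) * (Real.exp (-(Rc * h)) * (Rc * h)) * ∫ ω, Y 0 1 ω ∂μ ≤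
      ∫ ω, B.indicator (fun ω => lifted T h F (x s ω)) ω ∂μ -
        ∫ ω, B.indicator (fun _ => C + 1) ω ∂μ - ∫ ω, Z.indicator (fun _ => κ * h) ω ∂μ +
        ∫ ω, B.indicator (fun _ => Q * h ^ 2) ω ∂μ := by
    have i1 : Integrable (fun ω => Real.exp (-(R₀ * h)) * Real.exp (-(Rc * h)) * Y 0 0 ω +
        Real.exp (-(R₀ * h)) * (R₀ * h) * Real.exp (-(Rc * h)) * Y 1 0 ω) μ :=
      ((hYi 0 0).const_mul _).add ((hYi 1 0).const_mul _)
    have i2 : Integrable (fun ω => B.indicator (fun ω => lifted T h F (x s ω)) ω -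
        B.indicator (fun _ => C + 1) ω) μ := hVs.sub hKi
    have i3 : Integrable (fun ω => B.indicator (fun ω => lifted T h F (x s ω)) ω -
        B.indicator (fun _ => C + 1) ω - Z.indicator (fun _ => κ * h) ω) μ := i2.sub hZi
    rw [← integral_const_mul, ← integral_const_mul, ← integral_const_mul,
      ← integral_add ((hYi 0 0).const_mul _) ((hYi 1 0).const_mul _),
      ← integral_add i1 ((hYi 0 1).const_mul _),
      ← integral_sub hVs hKi, ← integral_sub i2 hZi, ← integral_add i3 hQi]
    refine integral_mono (i1.add ((hYi 0 1).const_mul _)) (i3.add hQi) fun ω => ?_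
    by_cases hω : ω ∈ B
    · have hb := hF.step_bound R₀.2 Rc.2 hκ0 hκ1 hh0 hh₀ (hpos ω hω)
      have hZω : Z.indicator (fun _ => κ * h) ω =
          (Iio (T + h)).indicator (fun _ => κ * h) (x s ω) := by
        by_cases hω' : x s ω < T + h
        · rw [indicator_of_mem (show ω ∈ Z from ⟨hω, hω'⟩),
            indicator_of_mem (show x s ω ∈ Iio (T + h) from hω')]
        · rw [indicator_of_notMem (fun h' : ω ∈ Z => hω' h'.2),
            indicator_of_notMem (show x s ω ∉ Iio (T + h) from hω')]
      simp only [hY, indicator_of_mem hω, hZω, hφ]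
      norm_num
      exact hb
    · have hZω : ω ∉ Z := fun h' => hω h'.1
      simp [hY, hω, hZω]
  have hZv : ∫ ω, Z.indicator (fun _ => κ * h) ω ∂μ = κ * h * μ.real Z := by
    rw [integral_indicator_const _ hZm, smul_eq_mul, mul_comm]
  have hQv : ∫ ω, B.indicator (fun _ => Q * h ^ 2) ω ∂μ ≤ Q * h ^ 2 := by
    rw [integral_indicator_const _ hBm, smul_eq_mul]
    exact mul_le_of_le_one_left (by positivity) measureReal_le_one
  linarith

/-- The event that the buffer exceeds `θ` at the times `0, δ, …, k δ`. -/
def survives (x : ℝ≥0 → Ω → ℝ) (δ : ℝ≥0) (θ : ℝ) (k : ℕ) : Set Ω :=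
  {ω | ∀ j ≤ k, θ < x (j * δ) ω}

lemma survives_succ {Ω : Type*} (x : ℝ≥0 → Ω → ℝ) (δ : ℝ≥0) (θ : ℝ) (k : ℕ) :
    survives x δ θ (k + 1) = survives x δ θ k ∩ {ω | θ < x ((k + 1 : ℕ) * δ) ω} := by
  ext ω
  constructor
  · exact fun h => ⟨fun j hj => h j (by omega), h (k + 1) le_rfl⟩
  · rintro ⟨h1, h2⟩ j hj
    rcases Nat.le_succ_iff.1 hj with h | rfl
    · exact h1 j h
    · exact h2

lemma measurableSet_survives {Ω : Type*} {N Nc : ℝ≥0 → Ω → ℕ} {x : ℝ≥0 → Ω → ℝ}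
    {π : ℝ → ℕ} (hx : IsBufferProcess N Nc π D x) (δ : ℝ≥0) (θ : ℝ)
    (k : ℕ) : MeasurableSet[arrivalHistory N Nc (k * δ)] (survives x δ θ k) := by
  have : survives x δ θ k = ⋂ j ∈ Finset.range (k + 1), {ω | θ < x (j * δ) ω} := by
    ext ω; simp [survives]
  rw [this]
  refine Finset.measurableSet_biInter _ fun j hj => ?_
  have hjk : (j : ℝ≥0) * δ ≤ k * δ := by
    have : (j : ℝ≥0) ≤ k := by
      exact_mod_cast Nat.lt_succ_iff.1 (Finset.mem_range.1 hj)
    exact mul_le_mul_of_nonneg_right this (zero_le (a := δ))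
  exact ((hx.adapted _).mono (arrivalHistory_mono hjk) le_rfl) measurableSet_Ioi

/-- Dynkin's inequality on a time grid of step `δ`: a supersolution bounds the probability that the
buffer falls to the level `θ`, and the time it spends below the threshold before. -/
theorem grid_drift (hN : IsPoissonProcess μ R₀ N) (hNc : IsPoissonProcess μ Rc Nc)
    (hindep : IndepFun (fun ω t => N t ω) (fun ω t => Nc t ω) μ)
    (hx : IsBufferProcess N Nc (riskyPolicy T) D x)
    (hF : IsSupersolution R₀ Rc T κ h₀ C F) (hT : 0 ≤ T) (hκ0 : 0 ≤ κ) (hκ1 : κ ≤ 1)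
    {δ : ℝ≥0} (hδ0 : 0 < δ) (hδ₀ : δ ≤ h₀) (hδ1 : δ ≤ 1)
    (hθ0 : 0 ≤ θ) (hθδ : θ ≤ δ) (hθ : θ = δ ∨ F 0 ≤ F 1) (hθD : θ < D) (n : ℕ) :
    (F 0 - C * δ) * (1 - μ.real (survives x δ θ n)) +
      κ * δ * ∑ k ∈ Finset.range n, μ.real (survives x δ θ k ∩ {ω | x (k * δ) ω < T + δ}) ≤
    F D + δ + n * ((κ * (R₀ + Rc) + C + (R₀ + Rc) * (2 * C + 1) +
      (C + 1) * (R₀ + Rc) ^ 2) * δ ^ 2) := by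
  set Q := κ * (R₀ + Rc) + C + (R₀ + Rc) * (2 * C + 1) + (C + 1) * ((R₀ : ℝ) + Rc) ^ 2 with hQ
  have hδ0' : (0 : ℝ) < δ := hδ0
  have hδ1' : (δ : ℝ) ≤ 1 := hδ1
  have hle := arrivalHistory_le hN.measurable hNc.measurable
  have hXm : ∀ r, Measurable (x r) := fun r => (hx.adapted r).mono (hle r) le_rfl
  have hSm : ∀ k, MeasurableSet (survives x δ θ k) := fun k =>
    hle _ _ (measurableSet_survives hx δ θ k)
  set a : ℕ → ℝ := fun k =>
    ∫ ω, (survives x δ θ k).indicator (fun ω => lifted T δ F (x (k * δ) ω)) ω ∂μ with ha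
  have hpos : ∀ k, ∀ ω ∈ survives x δ θ k, 0 < x (k * δ) ω := fun k ω hω =>
    hθ0.trans_lt (hω k le_rfl)
  have hanonneg : ∀ k, 0 ≤ a k := fun k => integral_nonneg fun ω => indicator_nonneg
    (fun ω hω => (hF.nonneg _ (hpos k ω hω).le).trans (le_lifted hδ0'.le)) ω
  have key : ∀ n : ℕ, a n + (F 0 - C * δ) * (1 - μ.real (survives x δ θ n)) +
      κ * δ * ∑ k ∈ Finset.range n, μ.real (survives x δ θ k ∩ {ω | x (k * δ) ω < T + δ}) ≤
      F D + δ + n * (Q * δ ^ 2) := by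
    intro n
    induction n with
    | zero =>
      have h0 : survives x δ θ 0 = univ := by
        refine eq_univ_of_forall fun ω j hj => ?_
        obtain rfl : j = 0 := by omega
        have := (hx.isBufferPath hN hNc ω).initial
        simpa [this] using hθD
      have hx0 : ∀ ω, x 0 ω = D := fun ω => (hx.isBufferPath hN hNc ω).initial
      simp only [ha, h0, indicator_univ, Nat.cast_zero, zero_mul, hx0, integral_const,
        probReal_univ, one_smul, sub_self, mul_zero, add_zero, Finset.range_zero, Finset.sum_empty]
      exact lifted_le hδ0'.le
    | succ k ih =>
      have hst : (k : ℝ≥0) * δ ≤ (k + 1 : ℕ) * δ := by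
        refine mul_le_mul_of_nonneg_right ?_ (zero_le (a := δ))
        exact_mod_cast Nat.le_succ k
      have hdiff : (((k + 1 : ℕ) * δ : ℝ≥0) : ℝ) - ((k * δ : ℝ≥0) : ℝ) = δ := by
        push_cast; ring
      have hstep := integral_step_le hN hNc hindep hx hF hT hκ0 hκ1 hst hdiff hδ0' hδ₀ hδ1' hθ0 hθ
        (measurableSet_survives hx δ θ k) fun ω hω => hω k le_rfl
      -- A path that fails at this step ends in `[-δ, θ]`, within `δ` of `0`, so its value is at
      -- least `F 0 - C δ`.
      have hsplit : a (k + 1) + (F 0 - C * δ) *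
          (μ.real (survives x δ θ k) - μ.real (survives x δ θ (k + 1))) ≤
          ∫ ω, (survives x δ θ k).indicator
            (fun ω => lifted T δ F (x ((k + 1 : ℕ) * δ) ω)) ω ∂μ := by
        have hsub : survives x δ θ (k + 1) ⊆ survives x δ θ k := by
          rw [survives_succ]; exact inter_subset_left
        have hge : ∀ ω ∈ survives x δ θ k, -δ ≤ x ((k + 1 : ℕ) * δ) ω := fun ω hω => by
          have h1 := (hx.isBufferPath hN hNc ω).sub_le hst
          rw [hdiff] at h1
          linarith [hpos k ω hω]
        have hi : Integrable ((survives x δ θ k).indicator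
            fun ω => lifted T δ F (x ((k + 1 : ℕ) * δ) ω)) μ :=
          integrable_indicator_comp (hXm _) (hSm k) hF.measurable_lifted fun ω hω =>
            hF.abs_lifted_le hδ0'.le hδ1' (by linarith [hge ω hω])
        have hi' : Integrable ((survives x δ θ (k + 1)).indicator
            fun ω => lifted T δ F (x ((k + 1 : ℕ) * δ) ω)) μ :=
          integrable_indicator_comp (hXm _) (hSm _) hF.measurable_lifted fun ω hω =>
            hF.abs_lifted_le hδ0'.le hδ1' (by linarith [hpos _ ω hω])
        have hd : MeasurableSet (survives x δ θ k \ survives x δ θ (k + 1)) :=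
          (hSm k).diff (hSm _)
        have hic : Integrable ((survives x δ θ k \ survives x δ θ (k + 1)).indicator
            fun _ => F 0 - C * δ) μ := (integrable_const _).indicator hd
        rw [← measureReal_sdiff hsub (hSm _), mul_comm, ← smul_eq_mul,
          ← integral_indicator_const _ hd, ← integral_add hi' hic]
        refine integral_mono (hi'.add hic) hi fun ω => ?_
        by_cases hω : ω ∈ survives x δ θ (k + 1)
        · simp [hω, hsub hω]
        · by_cases hω' : ω ∈ survives x δ θ k
          · have hlow : x ((k + 1 : ℕ) * δ) ω ≤ θ := by
              by_contra! h
              exact hω (by rw [survives_succ]; exact ⟨hω', h⟩)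
            have h1 := hge ω hω'
            have h2 := hF.lipschitz 0 (x ((k + 1 : ℕ) * δ) ω) (by norm_num) (by linarith)
            have h3 : C * |0 - x ((k + 1 : ℕ) * δ) ω| ≤ C * δ := by
              refine mul_le_mul_of_nonneg_left ?_ hF.C_nonneg
              rw [abs_le]; constructor <;> linarith
            have h4 := le_lifted (T := T) (F := F) (x := x ((k + 1 : ℕ) * δ) ω) hδ0'.le
            have hm : ω ∈ survives x δ θ k \ survives x δ θ (k + 1) := ⟨hω', hω⟩
            simp only [indicator_of_notMem hω, indicator_of_mem hω', indicator_of_mem hm]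
            linarith
          · simp [hω, hω']
      rw [Finset.sum_range_succ]
      push_cast at *
      have hak : a k = ∫ ω, (survives x δ θ k).indicator
        (fun ω => lifted T δ F (x (k * δ) ω)) ω ∂μ := rfl
      linarith
  have := key n
  have := hanonneg n
  linarith

end Drift

/-! ### The interruption time of a path -/

section Interruption

variable {y : ℝ≥0 → ℝ} {t : ℝ≥0}

lemma pos_of_lt_interruptionTime (h : (t : ℝ≥0∞) < interruptionTime y) : 0 < y t := by
  by_contra! h'
  exact not_lt.2 (iInf₂_le t h') h

lemma le_interruptionTime {c : ℝ≥0∞} (h : ∀ t : ℝ≥0, (t : ℝ≥0∞) < c → 0 < y t) :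
    c ≤ interruptionTime y := by
  refine le_iInf₂ fun t ht => ?_
  by_contra! h'
  exact not_lt.2 ht (h t h')

end Interruption

/-! ### Refining the grid -/

section Limit

variable {Ω : Type*} [MeasurableSpace Ω] {μ : Measure Ω} [IsProbabilityMeasure μ]
  {N Nc : ℝ≥0 → Ω → ℕ} {R₀ Rc : ℝ≥0} {T D h₀ C : ℝ} {F : ℝ → ℝ} {x : ℝ≥0 → Ω → ℝ}

/-- The step of the `j`-th time grid; the grid is used up to time `j + 1`. -/
noncomputable def gridStep (j : ℕ) : ℝ≥0 := (((j : ℝ≥0) + 1) ^ 2)⁻¹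

lemma gridStep_pos (j : ℕ) : 0 < gridStep j := by unfold gridStep; positivity

lemma gridStep_coe (j : ℕ) : (gridStep j : ℝ) = (1 / ((j : ℝ) + 1)) ^ 2 := by
  simp [gridStep]

lemma mul_gridStep (j : ℕ) : (((j + 1) ^ 3 : ℕ) : ℝ≥0) * gridStep j = j + 1 := by
  unfold gridStep
  push_cast
  field_simp

lemma gridStep_coe_le (j : ℕ) : (gridStep j : ℝ) ≤ 1 / ((j : ℝ) + 1) := by
  rw [gridStep_coe, pow_two]
  refine mul_le_of_le_one_left (by positivity) ?_
  rw [div_le_one (by positivity)]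
  linarith [Nat.cast_nonneg (α := ℝ) j]

lemma gridStep_le_one (j : ℕ) : gridStep j ≤ 1 := by
  have h : (gridStep j : ℝ) ≤ 1 := by
    refine (gridStep_coe_le j).trans ?_
    rw [div_le_one (by positivity)]
    linarith [Nat.cast_nonneg (α := ℝ) j]
  exact_mod_cast h

lemma tendsto_gridStep : Tendsto (fun j => (gridStep j : ℝ)) atTop (𝓝 0) :=
  squeeze_zero (fun j => (gridStep j).2) gridStep_coe_le tendsto_one_div_add_atTop_nhds_zero_nat

lemma grid_error (Q : ℝ) (j : ℕ) :
    (((j + 1) ^ 3 : ℕ) : ℝ) * (Q * (gridStep j : ℝ) ^ 2) = Q * (1 / ((j : ℝ) + 1)) := by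
  rw [gridStep_coe]
  push_cast
  field_simp

/-- Between grid times the buffer loses less than `δ`, so a margin of `δ` at the grid times excludes
interruption in between. -/
lemma le_interruptionTime_of_survives {μ : Measure Ω} {π : ℝ → ℕ}
    (hN : IsPoissonProcess μ R₀ N) (hNc : IsPoissonProcess μ Rc Nc)
    (hx : IsBufferProcess N Nc π D x) {δ : ℝ≥0} (hδ : 0 < δ) {n : ℕ} {ω : Ω}
    (hω : ω ∈ survives x δ δ n) :
    ((n * δ : ℝ≥0) : ℝ≥0∞) ≤ interruptionTime fun t => x t ω := by
  refine le_interruptionTime fun t ht => ?_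
  rw [ENNReal.coe_lt_coe] at ht
  set k := ⌊t / δ⌋₊ with hk
  have h1 : (k : ℝ≥0) * δ ≤ t := (le_div_iff₀ hδ).1 (Nat.floor_le (zero_le (a := t / δ)))
  have h2 : t < (k + 1) * δ := (div_lt_iff₀ hδ).1 (Nat.lt_floor_add_one _)
  have h3 : k ≤ n := by
    have : (k : ℝ≥0) * δ < n * δ := h1.trans_lt ht
    exact_mod_cast (lt_of_mul_lt_mul_right this (zero_le (a := δ))).le
  have h4 := hω k h3
  have h5 := (hx.isBufferPath hN hNc ω).sub_le h1
  have h6 : (t : ℝ) < (k + 1) * δ := by exact_mod_cast h2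
  push_cast at h5
  linarith

/-- A supersolution that equals `1` at `0` bounds the interruption probability. -/
theorem interruptionProb_le (hN : IsPoissonProcess μ R₀ N) (hNc : IsPoissonProcess μ Rc Nc)
    (hindep : IndepFun (fun ω t => N t ω) (fun ω t => Nc t ω) μ)
    (hx : IsBufferProcess N Nc (riskyPolicy T) D x)
    (hF : IsSupersolution R₀ Rc T 0 h₀ C F) (hT : 0 ≤ T) (hh₀ : 0 < h₀) (hD : 0 < D)
    (hF0 : F 0 = 1) : interruptionProb μ x ≤ ENNReal.ofReal (F D) := by
  set Q := (0 : ℝ) * (R₀ + Rc) + C + (R₀ + Rc) * (2 * C + 1) + (C + 1) * ((R₀ : ℝ) + Rc) ^ 2 with hQ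
  have hC := hF.C_nonneg
  have key : ∀ M : ℕ, μ {ω | interruptionTime (fun t => x t ω) < M} ≤ ENNReal.ofReal (F D) := by
    intro M
    rw [← ofReal_measureReal (measure_ne_top _ _)]
    refine ENNReal.ofReal_le_ofReal ?_
    have hlim : Tendsto (fun j : ℕ => F D + (1 + C) * (gridStep j : ℝ) + Q * (1 / ((j : ℝ) + 1)))
        atTop (𝓝 (F D + (1 + C) * 0 + Q * 0)) :=
      ((tendsto_gridStep.const_mul _).const_add _).add
        (tendsto_one_div_add_atTop_nhds_zero_nat.const_mul _)
    rw [mul_zero, mul_zero, add_zero, add_zero] at hlim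
    refine ge_of_tendsto hlim ?_
    filter_upwards [tendsto_gridStep.eventually_lt_const hh₀,
      tendsto_gridStep.eventually_lt_const hD,
      eventually_ge_atTop M] with j hj1 hj2 hjM
    have hd := grid_drift hN hNc hindep hx hF hT le_rfl zero_le_one (gridStep_pos j) hj1.le
      (gridStep_le_one j) (gridStep j).coe_nonneg le_rfl (Or.inl rfl) hj2 ((j + 1) ^ 3)
    rw [grid_error, hF0, zero_mul, zero_mul, add_zero] at hd
    set S := survives x (gridStep j) (gridStep j) ((j + 1) ^ 3) with hS
    have hSm : MeasurableSet S :=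
      arrivalHistory_le hN.measurable hNc.measurable _ _ (measurableSet_survives hx _ _ _)
    have hsub : {ω | interruptionTime (fun t => x t ω) < M} ⊆ Sᶜ := by
      intro ω hω hωS
      have h1 := le_interruptionTime_of_survives hN hNc hx (gridStep_pos j) hωS
      rw [mul_gridStep] at h1
      have h2 : (M : ℝ≥0∞) ≤ ((j + 1 : ℝ≥0) : ℝ≥0∞) := by
        have : (M : ℝ≥0) ≤ j + 1 := by exact_mod_cast hjM.trans (Nat.le_succ j)
        exact_mod_cast this
      exact not_lt.2 (h2.trans h1) hω
    have h3 := measureReal_mono hsub (measure_ne_top μ _)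
    rw [probReal_compl_eq_one_sub hSm] at h3
    have h4 : C * gridStep j * (1 - μ.real S) ≤ C * gridStep j :=
      mul_le_of_le_one_right (by positivity) (by linarith [measureReal_nonneg (μ := μ) (s := S)])
    linarith
  have hU : {ω | interruptionTime (fun t => x t ω) < ⊤} =
      ⋃ M : ℕ, {ω | interruptionTime (fun t => x t ω) < M} := by
    ext ω
    simp only [mem_ofPred_eq, mem_iUnion]
    exact ⟨fun h => ENNReal.exists_nat_gt h.ne, fun ⟨M, hM⟩ => hM.trans_le le_top⟩
  rw [interruptionProb, hU, Monotone.measure_iUnion]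
  · exact iSup_le key
  · intro a b hab ω hω
    have hω' : interruptionTime (fun t => x t ω) < a := hω
    exact hω'.trans_le (by exact_mod_cast hab)

/-- The time for which the costly server is used before time `M` is at most the total length of the
grid steps that start below `T + δ`, before the buffer is seen to be empty. -/
lemma usage_le_grid_sum {n nc : ℝ≥0 → ℕ} {y : ℝ≥0 → ℝ}
    (hy : IsBufferPath n nc (riskyPolicy T) D y) {δ : ℝ≥0} (hδ : 0 < δ) (m M : ℕ)
    (hM : (M : ℝ≥0) ≤ m * δ) :
    ∫⁻ t in {t : ℝ | (0 < t ∧ ENNReal.ofReal t < interruptionTime y) ∧ t ≤ M},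
      (action (riskyPolicy T) y t.toNNReal : ℝ≥0∞) ≤
    ∑ k ∈ Finset.range m, (δ : ℝ≥0∞) *
      {k : ℕ | (∀ j ≤ k, 0 < y (j * δ)) ∧ y (k * δ) < T + δ}.indicator 1 k := by
  set G := {k : ℕ | (∀ j ≤ k, 0 < y (j * δ)) ∧ y (k * δ) < T + δ} with hG
  have hSm : MeasurableSet {t : ℝ | (0 < t ∧ ENNReal.ofReal t < interruptionTime y) ∧ t ≤ M} :=
    (measurableSet_Ioi.inter (measurableSet_lt ENNReal.measurable_ofReal measurable_const)).inter
      measurableSet_Iic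
  have hδ' : (0 : ℝ) < δ := hδ
  set I : ℕ → Set ℝ := fun k => Ioc ((k : ℝ) * δ) ((k + 1) * δ) with hI
  calc _ ≤ ∫⁻ t in {t : ℝ | (0 < t ∧ ENNReal.ofReal t < interruptionTime y) ∧ t ≤ M},
        ∑ k ∈ Finset.range m, (I k).indicator (fun _ => G.indicator (1 : ℕ → ℝ≥0∞) k) t := by
        refine setLIntegral_mono' hSm fun t ht => ?_
        obtain ⟨⟨ht0, htτ⟩, htM⟩ := ht
        rcases riskyPolicy_eq_zero_or_one T (leftLim y t.toNNReal) with h0 | h1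
        · simp [action, h0]
        -- The ceiling gives `k δ < t ≤ (k + 1) δ`; strictness on the left is needed to bound the
        -- left limit at `t`.
        · set k := ⌈t / δ⌉₊ - 1 with hk
          have hceil : 0 < ⌈t / δ⌉₊ := Nat.ceil_pos.2 (div_pos ht0 hδ')
          have hk1 : ((k : ℝ) + 1) = ⌈t / δ⌉₊ := by
            have : k + 1 = ⌈t / δ⌉₊ := by omega
            exact_mod_cast this
          have hlow : (k : ℝ) * δ < t := by
            have : ⌈t / δ⌉₊ < t / δ + 1 := Nat.ceil_lt_add_one (div_pos ht0 hδ').le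
            rw [← lt_div_iff₀ hδ']
            linarith
          have hup : t ≤ (k + 1) * δ := by
            rw [hk1, ← div_le_iff₀ hδ']
            exact Nat.le_ceil _
          have hkm : k < m := by
            have hM' : (M : ℝ) ≤ m * δ := by exact_mod_cast hM
            have : (k : ℝ) * δ < m * δ := by linarith
            exact_mod_cast lt_of_mul_lt_mul_right this hδ'.le
          have htt : (t.toNNReal : ℝ) = t := Real.coe_toNNReal t ht0.le
          have hkG : k ∈ G := by
            constructor
            · intro j hj
              refine pos_of_lt_interruptionTime (lt_of_le_of_lt ?_ htτ)
              rw [ENNReal.ofReal, ENNReal.coe_le_coe]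
              have hjk : (j : ℝ) * δ ≤ k * δ :=
                mul_le_mul_of_nonneg_right (by exact_mod_cast hj) hδ'.le
              rw [← NNReal.coe_le_coe, htt]
              push_cast
              linarith
            · have hlt : (k : ℝ≥0) * δ < t.toNNReal := by
                rw [← NNReal.coe_lt_coe, htt]
                exact_mod_cast hlow
              have hll := hy.sub_le_leftLim hlt
              rw [htt] at hll
              push_cast at hll
              have : leftLim y t.toNNReal < T := by
                by_contra! hge
                rw [riskyPolicy_eq_zero hge] at h1
                exact zero_ne_one h1
              linarith
          have hone : (action (riskyPolicy T) y t.toNNReal : ℝ≥0∞) =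
              (I k).indicator (fun _ => G.indicator (1 : ℕ → ℝ≥0∞) k) t := by
            rw [indicator_of_mem (show t ∈ I k from ⟨hlow, hup⟩), indicator_of_mem hkG, action, h1]
            simp
          rw [hone]
          exact Finset.single_le_sum
            (f := fun k => (I k).indicator (fun _ => G.indicator (1 : ℕ → ℝ≥0∞) k) t)
            (fun _ _ => zero_le) (Finset.mem_range.2 hkm)
    _ ≤ ∫⁻ t, ∑ k ∈ Finset.range m, (I k).indicator (fun _ => G.indicator (1 : ℕ → ℝ≥0∞) k) t :=
        setLIntegral_le_lintegral _ _
    _ = _ := by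
        rw [lintegral_finsetSum _ fun k _ => measurable_const.indicator measurableSet_Ioc]
        refine Finset.sum_congr rfl fun k _ => ?_
        rw [lintegral_indicator_const measurableSet_Ioc, Real.volume_Ioc, mul_comm]
        congr 1
        rw [add_mul, one_mul, add_sub_cancel_left, ENNReal.ofReal_coe_nnreal]

/-- A supersolution that vanishes at `0` bounds the expected usage of the costly server. -/
theorem expectedUsage_le (hN : IsPoissonProcess μ R₀ N) (hNc : IsPoissonProcess μ Rc Nc)
    (hindep : IndepFun (fun ω t => N t ω) (fun ω t => Nc t ω) μ)
    (hx : IsBufferProcess N Nc (riskyPolicy T) D x)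
    (hF : IsSupersolution R₀ Rc T 1 h₀ C F) (hT : 0 ≤ T) (hh₀ : 0 < h₀) (hD : 0 < D)
    (hF0 : F 0 = 0) : expectedUsage μ (riskyPolicy T) x ≤ ENNReal.ofReal (F D) := by
  set Q := (1 : ℝ) * (R₀ + Rc) + C + (R₀ + Rc) * (2 * C + 1) + (C + 1) * ((R₀ : ℝ) + Rc) ^ 2 with hQ
  have hC := hF.C_nonneg
  have hF01 : F 0 ≤ F 1 := hF0.trans_le (hF.nonneg 1 zero_le_one)
  have hXm : ∀ r, Measurable (x r) := fun r =>
    (hx.adapted r).mono (arrivalHistory_le hN.measurable hNc.measurable r) le_rfl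
  set Z : ℕ → ℕ → Set Ω := fun j k =>
    survives x (gridStep j) 0 k ∩ {ω | x (k * gridStep j) ω < T + gridStep j} with hZ
  have hZm : ∀ j k, MeasurableSet (Z j k) := fun j k =>
    (arrivalHistory_le hN.measurable hNc.measurable _ _ (measurableSet_survives hx _ _ _)).inter
      (measurableSet_lt (hXm _) measurable_const)
  set U : ℕ → Ω → ℝ≥0∞ := fun j ω =>
    ∑ k ∈ Finset.range ((j + 1) ^ 3), (gridStep j : ℝ≥0∞) * (Z j k).indicator 1 ω with hU
  have hUm : ∀ j, Measurable (U j) := fun j => Finset.measurable_fun_sum _ fun k _ =>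
    (measurable_one.indicator (hZm j k)).const_mul _
  have hUint : ∀ j, ∫⁻ ω, U j ω ∂μ =
      ENNReal.ofReal (gridStep j * ∑ k ∈ Finset.range ((j + 1) ^ 3), μ.real (Z j k)) := by
    intro j
    simp only [hU]
    rw [lintegral_finsetSum _ fun k _ => (measurable_one.indicator (hZm j k)).const_mul _,
      Finset.mul_sum, ENNReal.ofReal_sum_of_nonneg fun k _ => by positivity]
    refine Finset.sum_congr rfl fun k _ => ?_
    rw [lintegral_const_mul _ (measurable_one.indicator (hZm j k)),
      lintegral_indicator_one (hZm j k),
      ENNReal.ofReal_mul (gridStep j).coe_nonneg, ENNReal.ofReal_coe_nnreal, ofReal_measureReal]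
  have hpath : ∀ ω, ∫⁻ t in {t : ℝ | 0 < t ∧ ENNReal.ofReal t < interruptionTime fun r => x r ω},
      (action (riskyPolicy T) (fun r => x r ω) t.toNNReal : ℝ≥0∞) ≤
      liminf (fun j => U j ω) atTop := by
    intro ω
    have hunion : {t : ℝ | 0 < t ∧ ENNReal.ofReal t < interruptionTime fun r => x r ω} =
        ⋃ M : ℕ, {t : ℝ |
          (0 < t ∧ ENNReal.ofReal t < interruptionTime fun r => x r ω) ∧ t ≤ M} := by
      ext t
      simp only [mem_ofPred_eq, mem_iUnion]
      exact ⟨fun h => (exists_nat_ge t).imp fun M hM => ⟨h, hM⟩, fun ⟨M, h⟩ => h.1⟩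
    rw [hunion, setLIntegral_iUnion_of_directed]
    · refine iSup_le fun M => le_liminf_of_le (by isBoundedDefault) ?_
      filter_upwards [eventually_ge_atTop M] with j hj
      have := usage_le_grid_sum (hx.isBufferPath hN hNc ω) (gridStep_pos j) ((j + 1) ^ 3) M (by
        rw [mul_gridStep]
        exact_mod_cast hj.trans (Nat.le_succ j))
      exact this
    · refine Monotone.directed_le fun a b hab t ht => ⟨ht.1, ht.2.trans ?_⟩
      exact_mod_cast hab
  -- Fatou's lemma is applied to the measurable grid sums, so measurability of the pathwise usage in
  -- `ω` is not needed.
  calc expectedUsage μ (riskyPolicy T) x ≤ ∫⁻ ω, liminf (fun j => U j ω) atTop ∂μ :=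
        lintegral_mono hpath
    _ ≤ liminf (fun j => ∫⁻ ω, U j ω ∂μ) atTop := lintegral_liminf_le hUm
    _ ≤ ENNReal.ofReal (F D) := by
        have hlim : Tendsto (fun j : ℕ => ENNReal.ofReal
            (F D + (1 + C) * (gridStep j : ℝ) + Q * (1 / ((j : ℝ) + 1))))
            atTop (𝓝 (ENNReal.ofReal (F D + (1 + C) * 0 + Q * 0))) :=
          ENNReal.tendsto_ofReal (((tendsto_gridStep.const_mul _).const_add _).add
            (tendsto_one_div_add_atTop_nhds_zero_nat.const_mul _))
        rw [mul_zero, mul_zero, add_zero, add_zero] at hlim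
        rw [← hlim.liminf_eq]
        refine liminf_le_liminf ?_
        filter_upwards [tendsto_gridStep.eventually_lt_const hh₀] with j hj
        rw [hUint]
        refine ENNReal.ofReal_le_ofReal ?_
        -- The level is `0`, not `δ`: before interruption the buffer is known only to be positive at
        -- grid times. The price is the condition `F 0 ≤ F 1`.
        have hd := grid_drift hN hNc hindep hx hF hT zero_le_one le_rfl (gridStep_pos j) hj.le
          (gridStep_le_one j) le_rfl (gridStep j).coe_nonneg (Or.inr hF01) hD ((j + 1) ^ 3)
        rw [grid_error, hF0, one_mul] at hd
        set S := survives x (gridStep j) 0 ((j + 1) ^ 3)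
        have h4 : C * gridStep j * (1 - μ.real S) ≤ C * gridStep j :=
          mul_le_of_le_one_right (by positivity)
            (by linarith [measureReal_nonneg (μ := μ) (s := S)])
        linarith

end Limit

/-! ### The two explicit barriers -/

section Bounds

variable {α₀ α₁ T : ℝ}

/-- The ratio `(1 - e^{-α₁ o}) / (1 - e^{-α₀ o})` is at most its limit `α₁ / α₀` at `0`. -/
lemma mul_one_sub_exp_le (hα₀ : 0 < α₀) (hα : α₀ ≤ α₁) (o : ℝ) :
    α₀ * (1 - Real.exp (-α₁ * o)) ≤ α₁ * (1 - Real.exp (-α₀ * o)) := by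
  have hα₁ : 0 < α₁ := hα₀.trans_le hα
  have h := convexOn_exp.2 (mem_univ (-α₁ * o)) (mem_univ 0)
    (show 0 ≤ α₀ / α₁ by positivity)
    (show 0 ≤ 1 - α₀ / α₁ by rw [sub_nonneg, div_le_one hα₁]; exact hα) (by ring)
  have e : (α₀ / α₁) • (-α₁ * o) + (1 - α₀ / α₁) • (0 : ℝ) = -α₀ * o := by
    simp only [smul_eq_mul]; field_simp; ring
  rw [e, Real.exp_zero, smul_eq_mul, smul_eq_mul, mul_one] at h
  have h2 := mul_le_mul_of_nonneg_left h hα₁.le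
  have e2 : α₁ * (α₀ / α₁ * Real.exp (-α₁ * o) + (1 - α₀ / α₁)) =
      α₀ * Real.exp (-α₁ * o) + α₁ - α₀ := by field_simp; ring
  linarith

/-- With `y = α o`, the product `(1 - y + y²/2)(1 + y + y²/2) = 1 + y⁴/4` turns the quadratic lower
bound on `e^y` into an upper bound on `e^{-y}`; then `o² ≤ o`. -/
lemma one_sub_exp_ge {α o : ℝ} (hα : 0 ≤ α) (ho : 0 ≤ o) (ho1 : o ≤ 1) :
    o * (α * (1 - α / 2)) ≤ 1 - Real.exp (-α * o) := by
  have hy : 0 ≤ α * o := mul_nonneg hα ho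
  have h := Real.quadratic_le_exp_of_nonneg hy
  have hq : 0 < 1 + α * o + (α * o) ^ 2 / 2 := by positivity
  have h2 : Real.exp (-α * o) ≤ 1 - α * o + (α * o) ^ 2 / 2 := by
    have h3 : Real.exp (-α * o) * Real.exp (α * o) = 1 := by
      rw [← Real.exp_add]; simp
    have h4 : Real.exp (-α * o) * (1 + α * o + (α * o) ^ 2 / 2) ≤ 1 := by
      exact (mul_le_mul_of_nonneg_left h (Real.exp_pos _).le).trans h3.le
    have h5 : 1 ≤ (1 - α * o + (α * o) ^ 2 / 2) * (1 + α * o + (α * o) ^ 2 / 2) := by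
      have : (1 - α * o + (α * o) ^ 2 / 2) * (1 + α * o + (α * o) ^ 2 / 2) =
          1 + ((α * o) ^ 2) ^ 2 / 4 := by ring
      rw [this]; linarith [sq_nonneg ((α * o) ^ 2)]
    exact le_of_mul_le_mul_right (h4.trans h5) hq
  have h6 : α ^ 2 * o ^ 2 ≤ α ^ 2 * o :=
    mul_le_mul_of_nonneg_left (by nlinarith) (sq_nonneg α)
  nlinarith

/-- The expected usage is bounded by this function of the initial buffer size. -/
lemma exists_usage_barrier {R₀ Rc : ℝ} (hα₀ : 0 < α₀) (hα₀2 : α₀ < 2) (hα : α₀ ≤ α₁) (hT : 0 < T)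
    (hR₀ : 1 < R₀) (hRc : 0 ≤ Rc) (hroot₀ : α₀ + R₀ * (Real.exp (-α₀) - 1) = 0)
    (hroot₁ : α₁ + (R₀ + Rc) * (Real.exp (-α₁) - 1) = 0)
    {a G : ℝ} (hG : G = betaConst α₀ α₁ / (α₁ * (R₀ + Rc - 1)))
    (ha : a = (G + T / (R₀ + Rc - 1)) / (1 - Real.exp (-α₁ * T))) :
    ∃ C, IsSupersolution R₀ Rc T 1 (1 / α₁) C
      (barrier a (-a) (-(1 / (R₀ + Rc - 1))) G α₀ α₁ T) := by
  have hα₁ : 0 < α₁ := hα₀.trans_le hα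
  have hr : 0 < R₀ + Rc - 1 := by linarith
  have hd : 0 < α₀ * (1 - α₀ / 2) := mul_pos hα₀ (by linarith)
  have hz1 : Real.exp (-α₁ * T) < 1 := Real.exp_lt_one_iff.2 (by nlinarith)
  have hz0 := Real.exp_pos (-α₁ * T)
  have hGr : G = 1 / (α₀ * (1 - α₀ / 2)) / (R₀ + Rc - 1) := by
    rw [hG, betaConst]; field_simp
  have hG0 : 0 < G := by rw [hGr]; positivity
  have ha0 : 0 < a := by
    rw [ha]; exact div_pos (by positivity) (by linarith)
  have hjoin : a * (1 - Real.exp (-α₁ * T)) = G + T / (R₀ + Rc - 1) := by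
    rw [ha]; exact div_mul_cancel₀ _ (by linarith)
  have hGd : G * (α₀ * (1 - α₀ / 2)) = 1 / (R₀ + Rc - 1) := by
    rw [hGr, div_mul_eq_mul_div, one_div_mul_cancel hd.ne']
  refine exists_isSupersolution_barrier hα₀ hα hT hG0.le (by linarith) hRc hroot₀ hroot₁ ?_ ?_ ?_ ?_
    ?_
  · field_simp
  · linear_combination hjoin
  · have h1 : 0 ≤ α₁ * (a * Real.exp (-α₁ * T)) := by positivity
    have h2 : 1 / (R₀ + Rc - 1) ≤ α₀ * G := by
      rw [← hGd]
      have : 0 ≤ G * α₀ * (α₀ / 2) := by positivity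
      linarith
    linarith
  -- At `T + o` the lower continuation is at least `G - o / (R₀ + Rc - 1)`, because `a > 0`. The
  -- upper part is at most that, because `G α₀ (1 - α₀/2) = 1 / (R₀ + Rc - 1)`.
  · intro o ho ho1
    have h1 := mul_le_mul_of_nonneg_left (one_sub_exp_ge hα₀.le ho ho1) hG0.le
    have h2 : Real.exp (-α₁ * (T + o)) ≤ Real.exp (-α₁ * T) := Real.exp_le_exp.2 (by nlinarith)
    have h3 := mul_le_mul_of_nonneg_left h2 ha0.le
    have h4 : G * (o * (α₀ * (1 - α₀ / 2))) = o * (1 / (R₀ + Rc - 1)) := by rw [← hGd]; ring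
    have h5 : a * (1 - Real.exp (-α₁ * T)) = G + T * (1 / (R₀ + Rc - 1)) := by
      rw [hjoin]; ring
    linarith
  · intro x hx hxT
    -- The lower part is concave in `x`, vanishes at `0` and equals `G > 0` at `T`; hence it lies
    -- above its chord.
    have h := convexOn_exp.2 (mem_univ (-α₁ * T)) (mem_univ 0)
      (show 0 ≤ x / T by positivity)
      (show 0 ≤ 1 - x / T by rw [sub_nonneg, div_le_one hT]; exact hxT) (by ring)
    have e : (x / T) • (-α₁ * T) + (1 - x / T) • (0 : ℝ) = -α₁ * x := by
      simp only [smul_eq_mul]; field_simp; ring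
    rw [e, Real.exp_zero, smul_eq_mul, smul_eq_mul, mul_one] at h
    have h1 : x / T * (a * (1 - Real.exp (-α₁ * T))) ≤ a * (1 - Real.exp (-α₁ * x)) := by
      have := mul_le_mul_of_nonneg_left h ha0.le
      linarith
    rw [hjoin] at h1
    have h2 : x / T * (G + T / (R₀ + Rc - 1)) = x / T * G + x * (1 / (R₀ + Rc - 1)) := by
      field_simp
    have h3 : 0 ≤ x / T * G := by positivity
    linarith

/-- The interruption probability is bounded by this function of the initial buffer size. -/
lemma exists_interruption_barrier {R₀ Rc : ℝ} (hα₀ : 0 < α₀) (hα : α₀ ≤ α₁) (hT : 0 < T)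
    (hR₀ : 0 ≤ R₀) (hRc : 0 ≤ Rc) (hroot₀ : α₀ + R₀ * (Real.exp (-α₀) - 1) = 0)
    (hroot₁ : α₁ + (R₀ + Rc) * (Real.exp (-α₁) - 1) = 0)
    {A : ℝ} (hA : A * (1 + (α₁ / α₀ - 1) * Real.exp (-α₁ * T)) = 1) :
    ∃ C, IsSupersolution R₀ Rc T 0 (1 / α₁) C
      (barrier (1 - A) A 0 (α₁ / α₀ * A * Real.exp (-α₁ * T)) α₀ α₁ T) := by
  have hα₁ : 0 < α₁ := hα₀.trans_le hα
  have hk : 1 ≤ α₁ / α₀ := by rwa [one_le_div hα₀]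
  have hz0 := Real.exp_pos (-α₁ * T)
  have hden : 0 < 1 + (α₁ / α₀ - 1) * Real.exp (-α₁ * T) := by nlinarith
  have hA0 : 0 < A := by
    by_contra! h
    nlinarith [mul_nonneg (neg_nonneg.2 h) hden.le]
  have hB : 1 - A = (α₁ / α₀ - 1) * (A * Real.exp (-α₁ * T)) := by linear_combination -hA
  have hB0 : 0 ≤ 1 - A := by rw [hB]; exact mul_nonneg (by linarith) (by positivity)
  refine exists_isSupersolution_barrier hα₀ hα hT (by positivity) hR₀ hRc hroot₀ hroot₁ (by ring)
    ?_ ?_ ?_ ?_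
  · linear_combination hB
  · have : α₀ * (α₁ / α₀ * A * Real.exp (-α₁ * T)) = α₁ * (A * Real.exp (-α₁ * T)) := by
      field_simp
    linarith
  · intro o _ _
    have h1 := mul_one_sub_exp_le hα₀ hα o
    have e : Real.exp (-α₁ * (T + o)) = Real.exp (-α₁ * T) * Real.exp (-α₁ * o) := by
      rw [← Real.exp_add]; ring_nf
    have h2 : 1 - Real.exp (-α₁ * o) ≤ α₁ / α₀ * (1 - Real.exp (-α₀ * o)) := by
      rw [div_mul_eq_mul_div, le_div_iff₀ hα₀]; linarith
    have h3 := mul_le_mul_of_nonneg_left h2 (mul_pos hA0 hz0).le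
    rw [e, hB]
    linarith
  · intro x _ _
    have := mul_pos hA0 (Real.exp_pos (-α₁ * x))
    linarith

end Bounds

/-! ### The threshold balances the interruption bound -/

section Threshold

variable {α₀ α₁ D ε : ℝ}

lemma ratio_le_betaConst (hα₀ : 0 < α₀) (hα₀2 : α₀ < 2) (hα₁ : 0 < α₁) :
    α₁ / α₀ ≤ betaConst α₀ α₁ := by
  unfold betaConst
  exact div_le_div_of_nonneg_left hα₁.le (mul_pos hα₀ (by linarith))
    (mul_le_of_le_one_right hα₀.le (by linarith))

lemma one_lt_betaConst (hα₀ : 0 < α₀) (hα₀2 : α₀ < 2) (hα : α₀ < α₁) : 1 < betaConst α₀ α₁ :=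
  ((one_lt_div hα₀).2 hα).trans_le (ratio_le_betaConst hα₀ hα₀2 (hα₀.trans hα))

/-- Above `D̄`, the threshold `T*` lies in `(0, D]` and balances the interruption probability. -/
lemma TStar_of_ge (hα₀ : 0 < α₀) (hα₀2 : α₀ < 2) (hα : α₀ < α₁) (hε : 0 < ε)
    (hD : D ≤ 1 / α₀ * Real.log (1 / ε)) (hDB : DBar α₀ α₁ ε ≤ D) :
    0 < TStar α₀ α₁ D ε ∧ TStar α₀ α₁ D ε ≤ D ∧
      betaConst α₀ α₁ * Real.exp (-α₁ * TStar α₀ α₁ D ε) *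
        Real.exp (-α₀ * (D - TStar α₀ α₁ D ε)) = ε := by
  have hβ := one_lt_betaConst hα₀ hα₀2 hα
  have hβ0 : 0 < betaConst α₀ α₁ := by linarith
  have hα₁ : 0 < α₁ := hα₀.trans hα
  have hd : 0 < α₁ - α₀ := by linarith
  have hT : (α₁ - α₀) * TStar α₀ α₁ D ε = Real.log (betaConst α₀ α₁ / ε) - α₀ * D := by
    rw [TStar, if_pos hDB]; field_simp
  have hlog : Real.log (betaConst α₀ α₁ / ε) =
      Real.log (betaConst α₀ α₁) + Real.log (1 / ε) := by
    rw [← Real.log_mul hβ0.ne' (by positivity)]; ring_nf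
  have hD' : α₀ * D ≤ Real.log (1 / ε) := by
    rw [one_div_mul_eq_div, le_div_iff₀ hα₀] at hD; linarith
  have hDB' : Real.log (betaConst α₀ α₁ / ε) ≤ α₁ * D := by
    rw [DBar, one_div_mul_eq_div, div_le_iff₀ hα₁] at hDB; linarith
  have hlogβ := Real.log_pos hβ
  refine ⟨?_, ?_, ?_⟩
  · refine pos_of_mul_pos_right (a := α₁ - α₀) ?_ hd.le
    rw [hT]; linarith
  · refine le_of_mul_le_mul_left ?_ hd
    rw [hT]; linarith
  · rw [mul_assoc, ← Real.exp_add]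
    have : -α₁ * TStar α₀ α₁ D ε + -α₀ * (D - TStar α₀ α₁ D ε) =
        -Real.log (betaConst α₀ α₁ / ε) := by linarith
    rw [this, Real.exp_neg, Real.exp_log (by positivity)]
    field_simp

/-- Below `D̄`, the threshold `T*` exceeds `D` and balances the interruption probability. -/
lemma TStar_of_lt (hα₀ : 0 < α₀) (hα₀2 : α₀ < 2) (hα : α₀ < α₁) (hε : 0 < ε)
    (hD0 : 0 < D) (hDB : D < DBar α₀ α₁ ε) (he : Real.exp (-α₁ * D) < ε) :
    D ≤ TStar α₀ α₁ D ε ∧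
      (1 - Real.exp (-α₁ * D)) * (1 - betaConst α₀ α₁ * Real.exp (-α₁ * TStar α₀ α₁ D ε)) =
        (1 - ε) * (1 - Real.exp (-α₁ * TStar α₀ α₁ D ε)) := by
  have hβ := one_lt_betaConst hα₀ hα₀2 hα
  have hβ0 : 0 < betaConst α₀ α₁ := by linarith
  have hα₁ : 0 < α₁ := hα₀.trans hα
  set β := betaConst α₀ α₁ with hβd
  set e := Real.exp (-α₁ * D) with hed
  have he0 : 0 < e := Real.exp_pos _
  have he1 : e < 1 := Real.exp_lt_one_iff.2 (by nlinarith)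
  have hden : 0 < ε - e := by linarith
  have hnum : 0 < ε + β * (1 - e) - 1 := by nlinarith
  set q := (ε + β * (1 - e) - 1) / (ε - e) with hq
  have hq0 : 0 < q := div_pos hnum hden
  have hT : TStar α₀ α₁ D ε = 1 / α₁ * Real.log q := by
    rw [TStar, if_neg (not_le.2 hDB)]
  have hz : Real.exp (-α₁ * TStar α₀ α₁ D ε) = (ε - e) / (ε + β * (1 - e) - 1) := by
    have : -α₁ * TStar α₀ α₁ D ε = -Real.log q := by rw [hT]; field_simp
    rw [this, Real.exp_neg, Real.exp_log hq0, hq, inv_div]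
  constructor
  -- This is `D < D̄` in exponential form, and it yields `e^{-α₁ T*} ≤ e^{-α₁ D}`.
  · have hβe : ε ≤ β * e := by
      have h1 : α₁ * D ≤ Real.log (β / ε) := by
        have := hDB.le
        rw [DBar, one_div_mul_eq_div, le_div_iff₀ hα₁] at this
        linarith
      have h2 : Real.exp (α₁ * D) ≤ β / ε := by
        rw [← Real.exp_log (show 0 < β / ε by positivity)]
        exact Real.exp_le_exp.2 h1
      rw [le_div_iff₀ hε] at h2
      have h3 := mul_le_mul_of_nonneg_right h2 he0.le
      have h4 : Real.exp (α₁ * D) * e = 1 := by rw [hed, ← Real.exp_add]; simp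
      nlinarith
    have hle : Real.exp (-α₁ * TStar α₀ α₁ D ε) ≤ e := by
      rw [hz, div_le_iff₀ hnum]
      nlinarith [mul_le_mul_of_nonneg_right hβe (by linarith : 0 ≤ 1 - e)]
    have := Real.exp_le_exp.1 (hed ▸ hle)
    by_contra! h
    nlinarith
  · rw [hz, mul_div_assoc', one_sub_div hnum.ne', one_sub_div hnum.ne', mul_div_assoc',
      mul_div_assoc']
    congr 1
    ring

end Threshold

/-! ### Feasibility of the threshold policy -/

section Feasible

variable {α₀ α₁ D ε T A : ℝ}

/-- The bound on the interruption probability, for an initial buffer above the threshold. -/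
lemma interruption_barrier_le_of_ge (hα₀ : 0 < α₀) (hα₀2 : α₀ < 2) (hα : α₀ < α₁)
    (hA : A * (1 + (α₁ / α₀ - 1) * Real.exp (-α₁ * T)) = 1) (hDT : T ≤ D)
    (h : betaConst α₀ α₁ * Real.exp (-α₁ * T) * Real.exp (-α₀ * (D - T)) = ε) :
    barrier (1 - A) A 0 (α₁ / α₀ * A * Real.exp (-α₁ * T)) α₀ α₁ T D ≤ ε := by
  have hα₁ := hα₀.trans hα
  have hk : 1 < α₁ / α₀ := (one_lt_div hα₀).2 hα
  have hkβ := ratio_le_betaConst hα₀ hα₀2 hα₁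
  have hz0 := Real.exp_pos (-α₁ * T)
  have hw : 0 < (α₁ / α₀ - 1) * Real.exp (-α₁ * T) := mul_pos (by linarith) hz0
  have hA1 : A ≤ 1 := by
    by_contra! h
    nlinarith
  rw [barrier_of_ge (by linear_combination -hA) hDT, ← h]
  refine mul_le_mul_of_nonneg_right (mul_le_mul_of_nonneg_right ?_ hz0.le) (Real.exp_pos _).le
  exact (mul_le_of_le_one_right (by linarith) hA1).trans hkβ

/-- The bound on the interruption probability, for an initial buffer below the threshold. -/
lemma interruption_barrier_le_of_le (hα₀ : 0 < α₀) (hα₀2 : α₀ < 2) (hα : α₀ < α₁) (hD0 : 0 < D)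
    (hA : A * (1 + (α₁ / α₀ - 1) * Real.exp (-α₁ * T)) = 1) (hDT : D ≤ T)
    (h : (1 - Real.exp (-α₁ * D)) * (1 - betaConst α₀ α₁ * Real.exp (-α₁ * T)) =
        (1 - ε) * (1 - Real.exp (-α₁ * T))) :
    barrier (1 - A) A 0 (α₁ / α₀ * A * Real.exp (-α₁ * T)) α₀ α₁ T D ≤ ε := by
  have hα₁ := hα₀.trans hα
  have hk : 1 < α₁ / α₀ := (one_lt_div hα₀).2 hα
  have hkβ := ratio_le_betaConst hα₀ hα₀2 hα₁
  rw [barrier_of_le hDT]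
  set k := α₁ / α₀
  set β := betaConst α₀ α₁
  set z := Real.exp (-α₁ * T) with hz
  set e := Real.exp (-α₁ * D) with he
  have hz0 : 0 < z := Real.exp_pos _
  have hz1 : z < 1 := Real.exp_lt_one_iff.2 (by nlinarith)
  have he1 : e < 1 := Real.exp_lt_one_iff.2 (by nlinarith)
  have hden : 0 < 1 + (k - 1) * z := by nlinarith
  have hA' : A = 1 / (1 + (k - 1) * z) := by field_simp; linarith
  have hA0 : 0 < A := by rw [hA']; positivity
  -- Replacing `β` by the smaller `k` suffices, since `(1 - k z)(1 + (k - 1) z) = 1 - z - k (k - 1)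
  -- z²`.
  have h1 : 1 - β * z ≤ A * (1 - z) := by
    have h2 : (1 - β * z) * (1 + (k - 1) * z) ≤ 1 - z := by
      have h3 : (1 - β * z) * (1 + (k - 1) * z) ≤ (1 - k * z) * (1 + (k - 1) * z) :=
        mul_le_mul_of_nonneg_right (by nlinarith) hden.le
      have h4 : 0 ≤ k * (k - 1) * z ^ 2 :=
        mul_nonneg (mul_nonneg (by linarith) (by linarith)) (sq_nonneg z)
      linarith
    rw [hA', one_div_mul_eq_div, le_div_iff₀ hden]
    exact h2
  have h5 := mul_le_mul_of_nonneg_left h1 (by linarith : 0 ≤ 1 - e)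
  rw [h] at h5
  have h6 : 1 - ε ≤ A * (1 - e) := by
    refine le_of_mul_le_mul_right ?_ (by linarith : 0 < 1 - z)
    linarith
  linarith

end Feasible

end Streaming

/-! ### Assembly of the two cost bounds -/

theorem mainTheorem3 {Ω : Type*} [MeasurableSpace Ω] (μ : Measure Ω) [IsProbabilityMeasure μ]
    (R₀ Rc : ℝ≥0) (hR₀ : 1 < R₀) (hRc : 0 < Rc)
    (N Nc : ℝ≥0 → Ω → ℕ)
    (hN : Streaming.IsPoissonProcess μ R₀ N) (hNc : Streaming.IsPoissonProcess μ Rc Nc)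
    (hindep : IndepFun (fun ω t => N t ω) (fun ω t => Nc t ω) μ)
    (R₁ α₀ α₁ β D ε Tstar : ℝ)
    (hR₁ : R₁ = R₀ + Rc)
    (hα₀ : α₀ = Streaming.rBar R₀) (hα₁ : α₁ = Streaming.rBar R₁) (hα₀_lt : α₀ < 2)
    (hβ : β = Streaming.betaConst α₀ α₁)
    (hregion : (D, ε) ∈ Streaming.region α₀ α₁)
    (hTstar : Tstar = Streaming.TStar α₀ α₁ D ε)
    (x : ℝ≥0 → Ω → ℝ)
    (hx : Streaming.IsBufferProcess N Nc (Streaming.riskyPolicy Tstar) D x) :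
    (Streaming.DBar α₀ α₁ ε ≤ D →
      (Streaming.cost μ (Streaming.riskyPolicy Tstar) x ε : EReal) ≤
        ((β / (α₁ * (R₁ - 1)) * Real.exp (-α₀ * (D - Tstar)) : ℝ) : EReal)) ∧
    (D ≤ Streaming.DBar α₀ α₁ ε → Real.exp (-α₁ * D) < ε →
      (Streaming.cost μ (Streaming.riskyPolicy Tstar) x ε : EReal) ≤
        (((1 - Real.exp (-α₁ * D)) / ((R₁ - 1) * (1 - Real.exp (-α₁ * Tstar))) *
            (Tstar + 1 + β / α₁) - D / (R₁ - 1) : ℝ) : EReal)) := by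
  have hR₀' : (1 : ℝ) < R₀ := hR₀
  have hRc' : (0 : ℝ) < Rc := hRc
  have hα₀0 : 0 < α₀ := hα₀ ▸ Streaming.rBar_pos hR₀'
  have hα : α₀ < α₁ := by
    rw [hα₀, hα₁, hR₁]; exact Streaming.rBar_lt_rBar hR₀' (by linarith)
  have hα₁0 : 0 < α₁ := hα₀0.trans hα
  have hroot₀ : α₀ + R₀ * (Real.exp (-α₀) - 1) = 0 := by
    rw [hα₀]; exact Streaming.rBar_root (by linarith)
  have hroot₁ : α₁ + (R₀ + Rc) * (Real.exp (-α₁) - 1) = 0 := by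
    rw [hα₁, hR₁]; exact Streaming.rBar_root (by linarith)
  have hr : 0 < (R₀ : ℝ) + Rc - 1 := by linarith
  obtain ⟨hε0, hε1, hDlow, hDup⟩ := hregion
  dsimp only at hε0 hε1 hDlow hDup
  have hD : 0 < D := by
    have : 0 < Real.log (1 / ε) := Real.log_pos ((one_lt_div hε0).2 hε1)
    exact lt_of_lt_of_le (by positivity) hDlow
  have hβ1 := Streaming.one_lt_betaConst hα₀0 hα₀_lt hα
  have main : ∀ (hT : 0 < Tstar),
      (∀ A, A * (1 + (α₁ / α₀ - 1) * Real.exp (-α₁ * Tstar)) = 1 →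
        Streaming.barrier (1 - A) A 0 (α₁ / α₀ * A * Real.exp (-α₁ * Tstar)) α₀ α₁ Tstar D ≤ ε) →
      ∀ a G, G = β / (α₁ * (R₁ - 1)) →
        a = (G + Tstar / (R₁ - 1)) / (1 - Real.exp (-α₁ * Tstar)) → ∀ bound : ℝ, 0 ≤ bound →
        Streaming.barrier a (-a) (-(1 / (R₁ - 1))) G α₀ α₁ Tstar D ≤ bound →
        (Streaming.cost μ (Streaming.riskyPolicy Tstar) x ε : EReal) ≤ (bound : EReal) := by
    intro hT hfeas a G hG ha bound hb0 hb
    have hden : 0 < 1 + (α₁ / α₀ - 1) * Real.exp (-α₁ * Tstar) := by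
      have h1 : 1 < α₁ / α₀ := (one_lt_div hα₀0).2 hα
      have := mul_pos (sub_pos.2 h1) (Real.exp_pos (-α₁ * Tstar))
      linarith
    have hA : 1 / (1 + (α₁ / α₀ - 1) * Real.exp (-α₁ * Tstar)) *
        (1 + (α₁ / α₀ - 1) * Real.exp (-α₁ * Tstar)) = 1 := one_div_mul_cancel hden.ne'
    obtain ⟨C, hC⟩ := Streaming.exists_interruption_barrier hα₀0 hα.le hT (by linarith) hRc'.le
      hroot₀ hroot₁ hA
    have hprob := Streaming.interruptionProb_le hN hNc hindep hx hC hT.le (by positivity) hD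
      (by rw [Streaming.barrier_of_le hT.le]; simp)
    have hprob' := hprob.trans (ENNReal.ofReal_le_ofReal (hfeas _ hA))
    rw [hβ, hR₁] at hG
    rw [hR₁] at ha hb
    obtain ⟨C', hC'⟩ := Streaming.exists_usage_barrier hα₀0 hα₀_lt hα.le hT hR₀' hRc'.le hroot₀
      hroot₁ hG ha
    have husage := Streaming.expectedUsage_le hN hNc hindep hx hC' hT.le (by positivity) hD
      (by rw [Streaming.barrier_of_le hT.le]; simp)
    have husage' := husage.trans (ENNReal.ofReal_le_ofReal hb)
    have hE := EReal.coe_ennreal_le_coe_ennreal_iff.2 husage'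
    rw [EReal.coe_ennreal_ofReal, max_eq_left hb0] at hE
    rwa [Streaming.cost, if_pos hprob']
  have hjoin : ∀ {a G : ℝ}, 0 < Tstar →
      a = (G + Tstar / (R₁ - 1)) / (1 - Real.exp (-α₁ * Tstar)) →
      a + -a * Real.exp (-α₁ * Tstar) + -(1 / (R₁ - 1)) * Tstar = G := by
    intro a G hT ha
    have hz1 : Real.exp (-α₁ * Tstar) < 1 := Real.exp_lt_one_iff.2 (by nlinarith)
    have : a * (1 - Real.exp (-α₁ * Tstar)) = G + Tstar / (R₁ - 1) := by
      rw [ha]; exact div_mul_cancel₀ _ (by linarith)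
    linear_combination this
  constructor
  · intro hDB
    obtain ⟨hT, hTD, hbal⟩ := Streaming.TStar_of_ge hα₀0 hα₀_lt hα hε0 hDup hDB
    rw [← hTstar] at hT hTD hbal
    have hG0 : 0 ≤ β / (α₁ * (R₁ - 1)) := by
      rw [hβ, hR₁]; exact div_nonneg (by linarith) (by positivity)
    refine main hT (fun A hA =>
      Streaming.interruption_barrier_le_of_ge hα₀0 hα₀_lt hα hA hTD hbal) _ _ rfl rfl _
      (by positivity) ?_
    rw [Streaming.barrier_of_ge (hjoin hT rfl) hTD]
  · intro hDB he
    have hcases : 0 < Tstar ∧ D ≤ Tstar ∧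
        ∀ A, A * (1 + (α₁ / α₀ - 1) * Real.exp (-α₁ * Tstar)) = 1 →
          Streaming.barrier (1 - A) A 0 (α₁ / α₀ * A * Real.exp (-α₁ * Tstar)) α₀ α₁ Tstar D ≤
            ε := by
      -- At `D = D̄` the first branch of `T*` applies and gives `T* = D`, so both formulas for the
      -- barrier are available there.
      rcases hDB.lt_or_eq with hlt | heq
      · obtain ⟨hDT, hbal⟩ := Streaming.TStar_of_lt hα₀0 hα₀_lt hα hε0 hD hlt he
        rw [← hTstar] at hDT hbal
        exact ⟨hD.trans_le hDT, hDT, fun A hA =>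
          Streaming.interruption_barrier_le_of_le hα₀0 hα₀_lt hα hD hA hDT hbal⟩
      · obtain ⟨hT, hTD, hbal⟩ := Streaming.TStar_of_ge hα₀0 hα₀_lt hα hε0 hDup heq.ge
        rw [← hTstar] at hT hTD hbal
        refine ⟨hT, ?_, fun A hA =>
          Streaming.interruption_barrier_le_of_ge hα₀0 hα₀_lt hα hA hTD hbal⟩
        have h1 : (α₁ - α₀) * Tstar = α₁ * D - α₀ * D := by
          have h2 : Real.log (Streaming.betaConst α₀ α₁ / ε) = α₁ * D := by
            rw [heq, Streaming.DBar]; field_simp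
          rw [hTstar, Streaming.TStar, if_pos heq.ge, h2]
          field_simp [(sub_pos.2 hα).ne']
        exact le_of_mul_le_mul_left (by linarith) (sub_pos.2 hα)
    obtain ⟨hT, hDT, hfeas⟩ := hcases
    have hz1 : 0 < 1 - Real.exp (-α₁ * Tstar) :=
      sub_pos.2 (Real.exp_lt_one_iff.2 (by nlinarith))
    have he1 : 0 < 1 - Real.exp (-α₁ * D) := sub_pos.2 (Real.exp_lt_one_iff.2 (by nlinarith))
    have hr1 : 0 < R₁ - 1 := by rw [hR₁]; exact hr
    set a := (β / (α₁ * (R₁ - 1)) + Tstar / (R₁ - 1)) / (1 - Real.exp (-α₁ * Tstar)) with ha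
    have hval : Streaming.barrier a (-a) (-(1 / (R₁ - 1))) (β / (α₁ * (R₁ - 1))) α₀ α₁ Tstar D ≤
        (1 - Real.exp (-α₁ * D)) / ((R₁ - 1) * (1 - Real.exp (-α₁ * Tstar))) *
            (Tstar + 1 + β / α₁) - D / (R₁ - 1) := by
      rw [Streaming.barrier_of_le hDT]
      -- The barrier gives the bound with `T* + β / α₁`; the extra `1` in the claim is slack.
      have e1 : a + -a * Real.exp (-α₁ * D) + -(1 / (R₁ - 1)) * D =
          (1 - Real.exp (-α₁ * D)) / ((R₁ - 1) * (1 - Real.exp (-α₁ * Tstar))) *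
            (Tstar + β / α₁) - D / (R₁ - 1) := by
        rw [ha]; field_simp; ring
      have e2 : 0 ≤ (1 - Real.exp (-α₁ * D)) / ((R₁ - 1) * (1 - Real.exp (-α₁ * Tstar))) := by
        positivity
      rw [e1]
      linarith
    -- The bound must be nonnegative to survive `ENNReal.ofReal`; this is inherited from the
    -- nonnegativity of the usage barrier.
    refine main hT hfeas a _ rfl rfl _ (le_trans ?_ hval) hval
    obtain ⟨C', hC'⟩ := Streaming.exists_usage_barrier (a := a) hα₀0 hα₀_lt hα.le hT hR₀' hRc'.le
      hroot₀ hroot₁ rfl (by rw [ha, hβ, hR₁])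
    have := hC'.nonneg D hD.le
    rwa [hβ, hR₁]
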